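/- Setting. Let $d\ge 5$ and let $\mathcal M^d$ be the set of probability measures on $\{\pm e_1,\dots,\pm e_d\}$. An environment is a point $\omega=(\omega(x,\cdot))_{x\in\mathbb Z^d}$ of $(\mathcal M^d)^{\mathbb Z^d}$. Given $\omega$ and $x\in\mathbb Z^d$, $P^x_\omega$ is the law of the Markov chain $(X(n))_{n\ge 0}$ on $\mathbb Z^d$ with $X(0)=x$ and transition probabilities $P_\omega(X(n+1)=y+e\mid X(n)=y)=\omega(y,e)$. For a probability measure $Q$ on $\mathcal M^d$ put $P=Q^{\mathbb Z^d}$, and let $\mathbb P^x(\cdot)=\int P^x_\omega(\cdot)\,dP(\omega)$ be the annealed law, $\mathbb P=\mathbb P^0$, with expectation $\mathbb E$. A time $t$ is a regeneration time of $X$ if $\langle X(s),e_1\rangle<\langle X(t),e_1\rangle$ for all $s<t$ and $\langle X(s),e_1\rangle\ge\langle X(t),e_1\rangle$ for all $s>t$; let $t^{(1)}<t^{(2)}<\cdots$ be the regeneration times of $X$ (under the assumptions below there are infinitely many, $\mathbb P$-a.s.). Assumptions on $Q$. (i) $Q$ is uniformly elliptic with constant $\kappa>0$: $Q(\omega(0,e)<\kappa)=0$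 for every $e\in\{\pm e_i\}$. (ii) There is a deterministic $v\in\mathbb R^d$ with $\langle v,e_1\rangle>0$ and $X(n)/n\to v$, $\mathbb P$-a.s. (iii) With this $v$, the annealed invariance principle holds: for some positive definite matrix $\sigma^2$, the linear interpolations on $[0,1]$ of $k/n\mapsto n^{-1/2}(X(k)-[kv])$ (integer parts taken coordinatewise) converge in distribution in $C([0,1],\mathbb R^d)$ with the supremum norm, under $\mathbb P$, as $n\to\infty$, to a Brownian motion with covariance $\sigma^2$. (iv) $\mathbb E[(t^{(1)})^{\varepsilon}]<\infty$ for some $\varepsilon>0$, and $\mathbb E[(t^{(2)}-t^{(1)})^{r}]<\infty$ for some $r\ge 2$. Proposition. For every $d\ge5$ and $\kappa>0$ there is a function $M\mapsto C_{d,\kappa}(M)$ such that the following holds for every $Q$ satisfying (i)–(iv), with $C=C_{d,\kappa}\big(\mathbb E[(t^{(2)}-t^{(1)})^2]\big)$. Let $U_1\ne U_2$ be points of $\mathbb Z^d$, let $Y_1,Y_2$ be independent with annealed laws $\mathbb P^{U_1}$, $\mathbb P^{U_2}$ (walks in independent environments), let $D_i=\{\langle Y_i(n),e_1\rangle\ge\langle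 U_i,e_1\rangle\ \text{for all } n\ge0\}$ and let $\mathbf P^D=\mathbb P^{U_1}(\cdot\mid D_1)\times\mathbb P^{U_2}(\cdot\mid D_2)$. Then $$\mathbf P^D\big(\{Y_1(n):n\ge0\}\cap\{Y_2(n):n\ge0\}\neq\emptyset\big)<C\,\|U_1-U_2\|^{-\frac{d-4}{d+4}},$$ where $\|\cdot\|$ is the supremum norm. -/

import Mathlib

open MeasureTheory ProbabilityTheory Filter Topology
open scoped ENNReal

noncomputable section

namespace RWRE

/-- The lattice `ℤ^d`. The norm that Mathlib puts on this type is the supremum norm. -/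
abbrev Lattice (d : ℕ) : Type := Fin d → ℤ

/-- The `2d` nearest-neighbour directions `± e_i`. -/
abbrev Dir (d : ℕ) : Type := Fin d × Bool

/-- The unit vector `± e_i` that belongs to a direction. -/
def Dir.vec {d : ℕ} (e : Dir d) : Lattice d := Pi.single e.1 (if e.2 then 1 else -1)

/-- The space of probability vectors on the set of the `2d` directions. -/
abbrev SiteLaw (d : ℕ) : Type := stdSimplex ℝ (Dir d)

/-- An environment assigns a probability vector on the directions to every site. -/
abbrev Env (d : ℕ) : Type := Lattice d → SiteLaw d

/-- Infinite trajectories in `ℤ^d`. -/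
abbrev Path (d : ℕ) : Type := ℕ → Lattice d

/-- The i.i.d. law on environments with marginal `Q`. -/
def envLaw {d : ℕ} (Q : Measure (SiteLaw d)) [IsProbabilityMeasure Q] : Measure (Env d) :=
  Measure.infinitePi fun _ : Lattice d ↦ Q

instance {d : ℕ} (Q : Measure (SiteLaw d)) [IsProbabilityMeasure Q] :
    IsProbabilityMeasure (envLaw Q) := by
  unfold envLaw; infer_instance

/-- Uniform ellipticity with constant `κ`. -/
def UniformlyElliptic {d : ℕ} (κ : ℝ) (Q : Measure (SiteLaw d)) : Prop :=
  ∀ e : Dir d, Q {p | p.1 e < κ} = 0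

/-! ### The quenched and the annealed laws -/

/-- The law of the position after one step from `x` in the environment `ω`. -/
def stepLaw {d : ℕ} (ω : Env d) (x : Lattice d) : Measure (Lattice d) :=
  ∑ e : Dir d, ENNReal.ofReal ((ω x).1 e) • Measure.dirac (x + e.vec)

instance {d : ℕ} (ω : Env d) (x : Lattice d) : IsProbabilityMeasure (stepLaw ω x) := by
  constructor
  simp only [stepLaw, Measure.coe_finsetSum, Finset.sum_apply, Measure.smul_apply,
    measure_univ, smul_eq_mul, mul_one]
  rw [← ENNReal.ofReal_sum_of_nonneg (fun e _ ↦ (ω x).2.1 e), (ω x).2.2, ENNReal.ofReal_one]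

/-- The transition kernel of the walk in the environment `ω`, as a function of the history up to
time `n`: only the position at time `n` matters. -/
def stepKernel {d : ℕ} (ω : Env d) (n : ℕ) :
    Kernel ((i : Finset.Iic n) → (fun _ : ℕ ↦ Lattice d) i) (Lattice d) where
  toFun h := stepLaw ω (h ⟨n, Finset.mem_Iic.2 le_rfl⟩)
  measurable' := measurable_of_countable _

instance {d : ℕ} (ω : Env d) (n : ℕ) : IsMarkovKernel (stepKernel ω n) :=
  ⟨fun h ↦ inferInstanceAs (IsProbabilityMeasure (stepLaw ω (h ⟨n, Finset.mem_Iic.2 le_rfl⟩)))⟩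

/-- The quenched law: the law of the Markov chain with the transition probabilities of `ω` that
starts at `x`. -/
def quenched {d : ℕ} (ω : Env d) (x : Lattice d) : Measure (Path d) :=
  Kernel.traj (X := fun _ ↦ Lattice d) (stepKernel ω) 0 (fun _ ↦ x)

instance {d : ℕ} (ω : Env d) (x : Lattice d) : IsProbabilityMeasure (quenched ω x) := by
  unfold quenched; infer_instance

lemma measurable_stepLaw_apply {d : ℕ} (x : Lattice d) (S : Set (Lattice d)) :
    Measurable fun ω : Env d ↦ stepLaw ω x S := by
  simp only [stepLaw, Measure.coe_finsetSum, Finset.sum_apply, Measure.smul_apply, smul_eq_mul]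
  refine Finset.measurable_sum _ fun e _ ↦ Measurable.mul_const ?_ _
  exact ENNReal.measurable_ofReal.comp
    ((measurable_pi_apply e).comp (measurable_subtype_coe.comp (measurable_pi_apply x)))

lemma measurable_partialTraj_succ {d : ℕ} (n : ℕ)
    (h : (i : Finset.Iic n) → (fun _ : ℕ ↦ Lattice d) i) :
    Measurable fun ω : Env d ↦
      Kernel.partialTraj (X := fun _ ↦ Lattice d) (stepKernel ω) n (n + 1) h := by
  refine Measure.measurable_of_measurable_coe _ fun S hS ↦ ?_
  have key : ∀ ω : Env d,
      Kernel.partialTraj (X := fun _ ↦ Lattice d) (stepKernel ω) n (n + 1) h S =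
        stepLaw ω (h ⟨n, Finset.mem_Iic.2 le_rfl⟩)
          {y | IicProdIoc (X := fun _ ↦ Lattice d) n (n + 1)
            (h, MeasurableEquiv.piSingleton (X := fun _ ↦ Lattice d) n y) ∈ S} := by
    intro ω
    have hS' : MeasurableSet (IicProdIoc (X := fun _ ↦ Lattice d) n (n + 1) ⁻¹' S) :=
      measurable_IicProdIoc hS
    rw [Kernel.partialTraj_succ_self, Kernel.map_apply' _ (by fun_prop) _ hS,
      Kernel.prod_apply, Kernel.id_apply, Measure.dirac_prod]
    refine (Measure.map_apply measurable_prodMk_left hS').trans ?_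
    rw [Kernel.map_apply' _ (by fun_prop) _ (measurable_prodMk_left hS')]
    rfl
  simp_rw [key]
  exact measurable_stepLaw_apply _ _

lemma measurable_partialTraj {d : ℕ} (x : Lattice d) (n : ℕ) :
    Measurable fun ω : Env d ↦
      Kernel.partialTraj (X := fun _ ↦ Lattice d) (stepKernel ω) 0 n (fun _ ↦ x) := by
  induction n with
  | zero => simp only [Kernel.partialTraj_self]; exact measurable_const
  | succ n ih =>
    refine Measure.measurable_of_measurable_coe _ fun S hS ↦ ?_
    have : ∀ ω : Env d,
        Kernel.partialTraj (X := fun _ ↦ Lattice d) (stepKernel ω) 0 (n + 1) (fun _ ↦ x) S =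
        ∑' h, Kernel.partialTraj (X := fun _ ↦ Lattice d) (stepKernel ω) n (n + 1) h S *
          Kernel.partialTraj (X := fun _ ↦ Lattice d) (stepKernel ω) 0 n (fun _ ↦ x) {h} := by
      intro ω
      rw [Kernel.partialTraj_succ_eq_comp (Nat.zero_le n), Kernel.comp_apply' _ _ _ hS,
        lintegral_countable']
    simp_rw [this]
    refine Measurable.tsum fun h ↦ ?_
    exact ((Measure.measurable_coe hS).comp (measurable_partialTraj_succ n h)).mul
      ((Measure.measurable_coe (measurableSet_singleton h)).comp ih)

lemma measurable_quenched {d : ℕ} (x : Lattice d) :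
    Measurable fun ω : Env d ↦ quenched ω x := by
  refine Measurable.measure_of_isPiSystem_of_isProbabilityMeasure
    (generateFrom_measurableCylinders (α := fun _ : ℕ ↦ Lattice d)).symm
    isPiSystem_measurableCylinders fun s hs ↦ ?_
  rw [measurableCylinders_nat] at hs
  simp only [Set.mem_iUnion, Set.mem_singleton_iff] at hs
  obtain ⟨n, S, hS, rfl⟩ := hs
  have : ∀ ω : Env d, quenched ω x (cylinder (Finset.Iic n) S) =
      Kernel.partialTraj (X := fun _ ↦ Lattice d) (stepKernel ω) 0 n (fun _ ↦ x) S := by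
    intro ω
    rw [← Kernel.traj_map_frestrictLe, Kernel.map_apply' _ (by fun_prop) _ hS]
    rfl
  simp_rw [this]
  exact (Measure.measurable_coe hS).comp (measurable_partialTraj x n)

/-- The quenched laws of the walks from `x`, as a Markov kernel from environments to paths. -/
def quenchedKernel {d : ℕ} (x : Lattice d) : Kernel (Env d) (Path d) where
  toFun ω := quenched ω x
  measurable' := measurable_quenched x

instance {d : ℕ} (x : Lattice d) : IsMarkovKernel (quenchedKernel x) :=
  ⟨fun ω ↦ inferInstanceAs (IsProbabilityMeasure (quenched ω x))⟩

/-- The annealed law `A ↦ ∫ P_ω^x(A) dP(ω)` of the walk from `x`. -/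
def annealed {d : ℕ} (Q : Measure (SiteLaw d)) [IsProbabilityMeasure Q] (x : Lattice d) :
    Measure (Path d) :=
  (envLaw Q).bind (quenchedKernel x)

instance {d : ℕ} (Q : Measure (SiteLaw d)) [IsProbabilityMeasure Q] (x : Lattice d) :
    IsProbabilityMeasure (annealed Q x) := by
  unfold annealed; infer_instance

/-! ### Regeneration times in direction `e_1` (the coordinate with index `0`) -/

/-- `t` is a regeneration time of the path `X`. -/
def IsRegenerationTime {d : ℕ} [NeZero d] (X : Path d) (t : ℕ) : Prop :=
  (∀ s, s < t → X s 0 < X t 0) ∧ ∀ s, t < s → X t 0 ≤ X s 0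

/-- `regTime X k` is the regeneration time `t^{(k+1)}`: the enumeration starts at `k = 0`. (The
default value `0` if there are too few regeneration times only occurs on a null set for the walks
considered below.) -/
def regTime {d : ℕ} [NeZero d] (X : Path d) (k : ℕ) : ℕ :=
  Nat.nth (IsRegenerationTime X) k

/-- `E[(t^{(1)})^s]` for the annealed walk from the origin. -/
def firstRegMoment {d : ℕ} [NeZero d] (Q : Measure (SiteLaw d)) [IsProbabilityMeasure Q]
    (s : ℝ) : ℝ≥0∞ :=
  ∫⁻ X, (regTime X 0 : ℝ≥0∞) ^ s ∂(annealed Q 0)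

/-- `E[(t^{(2)} - t^{(1)})^s]` for the annealed walk from the origin. -/
def regGapMoment {d : ℕ} [NeZero d] (Q : Measure (SiteLaw d)) [IsProbabilityMeasure Q]
    (s : ℝ) : ℝ≥0∞ :=
  ∫⁻ X, ((regTime X 1 - regTime X 0 : ℕ) : ℝ≥0∞) ^ s ∂(annealed Q 0)

/-! ### Law of large numbers and annealed invariance principle -/

/-- The position of the walk at time `n` as a vector of `ℝ^d`. -/
def realPos {d : ℕ} (X : Path d) (n : ℕ) : EuclideanSpace ℝ (Fin d) :=
  WithLp.toLp 2 fun i ↦ (X n i : ℝ)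

/-- `X(n) / n → v` almost surely under the annealed law. -/
def LawOfLargeNumbers {d : ℕ} (Q : Measure (SiteLaw d)) [IsProbabilityMeasure Q]
    (v : EuclideanSpace ℝ (Fin d)) : Prop :=
  ∀ᵐ X ∂(annealed Q 0), Tendsto (fun n : ℕ ↦ (n : ℝ)⁻¹ • realPos X n) atTop (𝓝 v)

/-- `B^n(k/n) = (X(k) - [k v]) / √n`, the integer part being taken in each coordinate. -/
def rescaled {d : ℕ} (v : EuclideanSpace ℝ (Fin d)) (n : ℕ) (X : Path d) (k : ℕ) :
    EuclideanSpace ℝ (Fin d) :=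
  (Real.sqrt n)⁻¹ • (realPos X k - WithLp.toLp 2 fun i ↦ ((⌊(k : ℝ) * v i⌋ : ℤ) : ℝ))

/-- The linear interpolation on `[0,1]` of `k/n ↦ B^n(k/n)`: on `[k/n, (k+1)/n]` it is
`B^n(k/n) + (n t - k) (B^n((k+1)/n) - B^n(k/n))`. -/
def interpolated {d : ℕ} (v : EuclideanSpace ℝ (Fin d)) (n : ℕ) (X : Path d) :
    C(unitInterval, EuclideanSpace ℝ (Fin d)) where
  toFun t := rescaled v n X 0 + ∑ k ∈ Finset.range n,
    max 0 (min 1 ((n : ℝ) * (t : ℝ) - k)) • (rescaled v n X (k + 1) - rescaled v n X k)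
  continuous_toFun := by fun_prop

instance {d : ℕ} : MeasurableSpace C(unitInterval, EuclideanSpace ℝ (Fin d)) := borel _

instance {d : ℕ} : BorelSpace C(unitInterval, EuclideanSpace ℝ (Fin d)) := ⟨rfl⟩

/-- `μ` is the law on `C([0,1], ℝ^d)` of the Brownian motion with covariance matrix `S`, started
at the origin. -/
structure IsBrownianLaw {d : ℕ} (S : Matrix (Fin d) (Fin d) ℝ)
    (μ : Measure C(unitInterval, EuclideanSpace ℝ (Fin d))) : Prop where
  zero : ∀ᵐ w ∂μ, w 0 = 0
  indep : HasIndepIncrements (fun (t : unitInterval) (w : C(unitInterval, _)) ↦ w t) μ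
  gaussian : ∀ s t : unitInterval, s ≤ t →
    HasLaw (fun w : C(unitInterval, _) ↦ w t - w s)
      (multivariateGaussian 0 (((t : ℝ) - (s : ℝ)) • S)) μ

/-- The annealed invariance principle with speed `v` and covariance matrix `S`. -/
def AnnealedInvariancePrinciple {d : ℕ} (Q : Measure (SiteLaw d)) [IsProbabilityMeasure Q]
    (v : EuclideanSpace ℝ (Fin d)) (S : Matrix (Fin d) (Fin d) ℝ) : Prop :=
  S.PosDef ∧
    ∃ μ : ProbabilityMeasure C(unitInterval, EuclideanSpace ℝ (Fin d)),
      IsBrownianLaw S (μ : Measure _) ∧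
      TendstoInDistribution (fun n : ℕ ↦ interpolated v n) atTop id
        (fun _ ↦ annealed Q 0) (μ : Measure _)

/-! ### Two walks in independent environments -/

/-- The event that the path never goes below its starting level in direction `e_1`. -/
def noBacktrack (d : ℕ) [NeZero d] : Set (Path d) :=
  {X | ∀ n, X 0 0 ≤ X n 0}

/-- The law of two independent annealed walks from `U₁` and `U₂`, each conditioned on never going
below its starting level. -/
def condPairLaw {d : ℕ} [NeZero d] (Q : Measure (SiteLaw d)) [IsProbabilityMeasure Q]
    (U₁ U₂ : Lattice d) : Measure (Path d × Path d) :=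
  ((annealed Q U₁)[|noBacktrack d]).prod ((annealed Q U₂)[|noBacktrack d])

/-- The event that the two paths have a common site. -/
def pathsIntersect (d : ℕ) : Set (Path d × Path d) :=
  {Y | (Set.range Y.1 ∩ Set.range Y.2).Nonempty}

end RWRE

end

/-!
Walks that intersect have a common site, so the union bound gives the estimate
`P(Y₁ and Y₂ intersect) ≤ ∑ x, F (x - U₁) * F (x - U₂)`, where `F x` is the probability that the
walk from the origin, conditioned not to backtrack (event `D`), visits `x`. The proof bounds `F`
through the renewal structure and then estimates the overlap.

*Renewal structure.* When a path arrives at a strict record of its level and does not backtrack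
afterwards, it has only used the environment below the record before, and only uses the
environment at or above it later. As the environment is i.i.d. the two parts factorize
(`annealed_inter_tail`). The positive speed makes the walk transient in direction `e₁`, whence
`P(D) > 0`; each first passage has conditional probability `P(D)` to be a regeneration time, and
therefore there are infinitely many of them (`ae_infinitely_many_regenerations`). Cutting the path
at its first regeneration after time zero shows that the regeneration points of the conditioned
walk form a random walk with step law `renewalLaw`, and that `F ≤ g * S`, where `g` is the Green
function of this random walk and `S` the occupation of one cycle (`visitWeight_le`,
`le_greenConv_of_renewal`). The displacement and the occupation of a cycle are controlled by the
second moment of its duration, which is at most `E[(t⁽²⁾ - t⁽¹⁾)²]` (`cycleSecondMoment_le`).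

*Decay of the Green function.* Ellipticity provides atoms of `renewalLaw` at `e₁`, `2e₁` and
`e₁ + e_j`, so that its characteristic function is at most `exp (-c |θ|²)` and the `k`-step
probabilities are `O(k ^ (-d/2))` (`convPow_le_of_atoms`). By Chebyshev's inequality the walk hits
`z` within `n ≪ ‖z‖` steps with probability `O(n / ‖z‖²)` (`greenUpTo_le_of_lt`); here no factor
is lost for the choice of the time, since the walk visits a site at most once. With
`n = ‖z‖ ^ (4/d)` both contributions to `g z` are `O(‖z‖ ^ (-α))` for `α = 2 - 4/d`
(`exists_green_le`).

*Overlap.* The random walk visits each level at most once, so `g` has mass at most one on every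
level. Let `γ = (d - 4)/(d + 4)`. Distributing the weight `(1 + ‖u‖) ^ γ` over the two factors of
`∑ x, g x * g (x + u)` and summing over levels bounds the weighted overlap by a multiple of
`∑ l, (1 + |l|) ^ (γ - α)`, which is finite because `α - γ > 1` (`green_overlap_le`). Smearing with
`S`, which has a first moment, preserves the rate (`greenConv_overlap_le`).
-/

namespace RWRE

/-! ### Cylinder events and the Markov property -/

variable {d : ℕ}

/-- The event that the path follows `γ` up to time `n`. -/
def cyl (γ : Path d) (n : ℕ) : Set (Path d) := {X | ∀ i ≤ n, X i = γ i}

/-- The path seen from time `n` on. -/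
def tail (n : ℕ) (X : Path d) : Path d := fun i ↦ X (n + i)

lemma measurable_tail (n : ℕ) : Measurable (tail n : Path d → Path d) :=
  measurable_pi_lambda _ fun i ↦ measurable_pi_apply (n + i)

lemma cyl_eq_preimage (γ : Path d) (n : ℕ) :
    cyl γ n = Preorder.frestrictLe (π := fun _ : ℕ ↦ Lattice d) n ⁻¹'
      {Preorder.frestrictLe (π := fun _ : ℕ ↦ Lattice d) n γ} := by
  ext X
  simp only [cyl, Set.mem_ofPred_eq, Set.mem_preimage, Set.mem_singleton_iff, funext_iff,
    Preorder.frestrictLe_apply, Subtype.forall, Finset.mem_Iic]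

lemma measurableSet_cyl (γ : Path d) (n : ℕ) : MeasurableSet (cyl γ n) := by
  rw [cyl_eq_preimage]
  exact (Preorder.measurable_frestrictLe n) (measurableSet_singleton _)

/-- Every restriction of a path to an initial segment of times extends to a path. -/
lemma exists_frestrictLe_eq (n : ℕ) (h : (i : Finset.Iic n) → (fun _ : ℕ ↦ Lattice d) i) :
    ∃ γ : Path d, Preorder.frestrictLe (π := fun _ : ℕ ↦ Lattice d) n γ = h :=
  ⟨fun i ↦ if hi : i ∈ Finset.Iic n then h ⟨i, hi⟩ else 0, by
    ext1 ⟨i, hi⟩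
    exact dif_pos hi⟩

/-- Finite measures on the path space are determined by their values on the cylinders `cyl γ n`. -/
lemma ext_of_cyl {μ ν : Measure (Path d)} [IsFiniteMeasure μ]
    (h : ∀ γ n, μ (cyl γ n) = ν (cyl γ n)) : μ = ν := by
  have hmap : ∀ n, μ.map (Preorder.frestrictLe (π := fun _ : ℕ ↦ Lattice d) n) =
      ν.map (Preorder.frestrictLe (π := fun _ : ℕ ↦ Lattice d) n) := by
    intro n
    refine Measure.ext_of_singleton fun g ↦ ?_
    obtain ⟨γ, rfl⟩ := exists_frestrictLe_eq n g
    rw [Measure.map_apply (Preorder.measurable_frestrictLe n) (measurableSet_singleton _),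
      Measure.map_apply (Preorder.measurable_frestrictLe n) (measurableSet_singleton _),
      ← cyl_eq_preimage, h]
  have hcyl : ∀ (n : ℕ) (S : Set ((i : Finset.Iic n) → (fun _ : ℕ ↦ Lattice d) i)),
      μ (cylinder (Finset.Iic n) S) = ν (cylinder (Finset.Iic n) S) := by
    intro n S
    have := congrArg (fun m ↦ m S) (hmap n)
    simp only at this
    rwa [Measure.map_apply (Preorder.measurable_frestrictLe n) S.to_countable.measurableSet,
      Measure.map_apply (Preorder.measurable_frestrictLe n) S.to_countable.measurableSet] at this
  refine ext_of_generate_finite (measurableCylinders fun _ : ℕ ↦ Lattice d)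
    (generateFrom_measurableCylinders (α := fun _ : ℕ ↦ Lattice d)).symm
    isPiSystem_measurableCylinders (fun s hs ↦ ?_) ?_
  · rw [measurableCylinders_nat] at hs
    simp only [Set.mem_iUnion, Set.mem_singleton_iff] at hs
    obtain ⟨n, S, -, rfl⟩ := hs
    exact hcyl n S
  · simpa using hcyl 0 Set.univ

lemma partialTraj_succ_singleton (ω : Env d) (γ : Path d) (n : ℕ)
    (h : (i : Finset.Iic n) → (fun _ : ℕ ↦ Lattice d) i) :
    Kernel.partialTraj (X := fun _ ↦ Lattice d) (stepKernel ω) n (n + 1) h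
      {Preorder.frestrictLe (π := fun _ : ℕ ↦ Lattice d) (n + 1) γ} =
    if h = Preorder.frestrictLe (π := fun _ : ℕ ↦ Lattice d) n γ then
      stepLaw ω (γ n) {γ (n + 1)} else 0 := by
  have hS : MeasurableSet
    {Preorder.frestrictLe (π := fun _ : ℕ ↦ Lattice d) (n + 1) γ} := measurableSet_singleton _
  have hS' := measurable_IicProdIoc (X := fun _ : ℕ ↦ Lattice d) (m := n) (n := n + 1) hS
  have key : Kernel.partialTraj (X := fun _ ↦ Lattice d) (stepKernel ω) n (n + 1) h
      {Preorder.frestrictLe (π := fun _ : ℕ ↦ Lattice d) (n + 1) γ} =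
      stepLaw ω (h ⟨n, Finset.mem_Iic.2 le_rfl⟩)
        {y | IicProdIoc (X := fun _ ↦ Lattice d) n (n + 1)
          (h, MeasurableEquiv.piSingleton (X := fun _ ↦ Lattice d) n y) ∈
          ({Preorder.frestrictLe (π := fun _ : ℕ ↦ Lattice d) (n + 1) γ} : Set _)} := by
    rw [Kernel.partialTraj_succ_self, Kernel.map_apply' _ (by fun_prop) _ hS,
      Kernel.prod_apply, Kernel.id_apply, Measure.dirac_prod]
    refine (Measure.map_apply measurable_prodMk_left hS').trans ?_
    rw [Kernel.map_apply' _ (by fun_prop) _ (measurable_prodMk_left hS')]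
    rfl
  have hmem : ∀ y : Lattice d, IicProdIoc (X := fun _ ↦ Lattice d) n (n + 1)
      (h, MeasurableEquiv.piSingleton (X := fun _ ↦ Lattice d) n y) ∈
      ({Preorder.frestrictLe (π := fun _ : ℕ ↦ Lattice d) (n + 1) γ} : Set _) ↔
      h = Preorder.frestrictLe (π := fun _ : ℕ ↦ Lattice d) n γ ∧ y = γ (n + 1) := by
    intro y
    rw [Set.mem_singleton_iff]
    constructor
    · intro H
      constructor
      · ext1 ⟨i, hi⟩
        have hi' := Finset.mem_Iic.1 hi
        have := congrFun H ⟨i, Finset.mem_Iic.2 (by lia)⟩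
        simpa [IicProdIoc, hi'] using this
      · have := congrFun H ⟨n + 1, Finset.mem_Iic.2 le_rfl⟩
        simpa [IicProdIoc, MeasurableEquiv.piSingleton] using this
    · rintro ⟨rfl, rfl⟩
      ext1 ⟨i, hi⟩
      have hi' := Finset.mem_Iic.1 hi
      by_cases hin : i ≤ n
      · simp [IicProdIoc, hin]
      · obtain rfl : i = n + 1 := by lia
        simp [IicProdIoc, MeasurableEquiv.piSingleton]
  rw [key]
  simp_rw [hmem]
  split_ifs with hh
  · subst hh
    simp only [true_and, Set.ofPred_eq_eq_singleton]
    rfl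
  · simp [hh]

lemma quenched_cyl (ω : Env d) (x : Lattice d) (γ : Path d) (n : ℕ) :
    quenched ω x (cyl γ n) =
      (if γ 0 = x then 1 else 0) * ∏ i ∈ Finset.range n, stepLaw ω (γ i) {γ (i + 1)} := by
  have hq : ∀ n, quenched ω x (cyl γ n) =
      Kernel.partialTraj (X := fun _ ↦ Lattice d) (stepKernel ω) 0 n (fun _ ↦ x)
        {Preorder.frestrictLe (π := fun _ : ℕ ↦ Lattice d) n γ} := by
    intro n
    rw [← Kernel.traj_map_frestrictLe, Kernel.map_apply' _ (by fun_prop) _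
      (measurableSet_singleton _), cyl_eq_preimage]
    rfl
  rw [hq]
  induction n with
  | zero =>
    simp only [Kernel.partialTraj_self, Finset.range_zero, Finset.prod_empty, mul_one]
    rw [Kernel.id_apply, Measure.dirac_apply, Set.indicator_apply]
    refine if_congr ?_ rfl rfl
    rw [Set.mem_singleton_iff]
    constructor
    · exact fun h ↦ (congrFun h ⟨0, Finset.mem_Iic.2 le_rfl⟩).symm
    · intro h
      ext1 ⟨i, hi⟩
      obtain rfl : i = 0 := by simpa using hi
      exact h.symm
  | succ n ih =>
    rw [Finset.prod_range_succ, ← mul_assoc, ← ih,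
      Kernel.partialTraj_succ_eq_comp (Nat.zero_le n),
      Kernel.comp_apply' _ _ _ (measurableSet_singleton _), lintegral_countable']
    simp_rw [partialTraj_succ_singleton]
    rw [tsum_eq_single (Preorder.frestrictLe (π := fun _ : ℕ ↦ Lattice d) n γ)]
    · rw [if_pos rfl, mul_comm]
    · intro h hh
      rw [if_neg hh, zero_mul]

/-- The Markov property of the quenched walk at a deterministic time. -/
lemma quenched_cyl_inter_tail (ω : Env d) (x : Lattice d) (γ : Path d) (n : ℕ)
    {B : Set (Path d)} (hB : MeasurableSet B) :
    quenched ω x (cyl γ n ∩ tail n ⁻¹' B) = quenched ω x (cyl γ n) * quenched ω (γ n) B := by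
  have key : ((quenched ω x).restrict (cyl γ n)).map (tail n) =
      (quenched ω x (cyl γ n)) • quenched ω (γ n) := by
    refine ext_of_cyl fun η m ↦ ?_
    rw [Measure.map_apply (measurable_tail n) (measurableSet_cyl η m),
      Measure.restrict_apply ((measurable_tail n) (measurableSet_cyl η m)), Measure.smul_apply,
      smul_eq_mul]
    by_cases h0 : η 0 = γ n
    · have hset : tail n ⁻¹' cyl η m ∩ cyl γ n =
          cyl (fun i ↦ if i ≤ n then γ i else η (i - n)) (n + m) := by
        ext X
        simp only [cyl, tail, Set.mem_inter_iff, Set.mem_preimage, Set.mem_ofPred_eq]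
        constructor
        · rintro ⟨h1, h2⟩ i hi
          split_ifs with hin
          · exact h2 i hin
          · have := h1 (i - n) (by lia)
            rwa [show n + (i - n) = i by lia] at this
        · intro h
          refine ⟨fun i hi ↦ ?_, fun i hi ↦ ?_⟩
          · rw [h (n + i) (by lia)]
            rcases Nat.eq_zero_or_pos i with rfl | hi0
            · simp [h0]
            · rw [if_neg (by lia), Nat.add_sub_cancel_left]
          · rw [h i (by lia), if_pos hi]
      rw [hset, quenched_cyl, quenched_cyl, quenched_cyl, Finset.prod_range_add, if_pos h0,
        one_mul, mul_assoc, if_pos (Nat.zero_le n)]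
      congr 2
      · refine Finset.prod_congr rfl fun i hi ↦ ?_
        have := Finset.mem_range.1 hi
        rw [if_pos (by lia), if_pos (by lia)]
      · refine Finset.prod_congr rfl fun i hi ↦ ?_
        rw [if_neg (by lia : ¬ n + i + 1 ≤ n), show n + i + 1 - n = i + 1 by lia]
        rcases Nat.eq_zero_or_pos i with rfl | hi0
        · simp [h0]
        · rw [if_neg (by lia), Nat.add_sub_cancel_left]
    · have hset : tail n ⁻¹' cyl η m ∩ cyl γ n = ∅ := by
        ext X
        simp only [cyl, tail, Set.mem_inter_iff, Set.mem_preimage, Set.mem_ofPred_eq,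
          Set.mem_empty_iff_false, iff_false, not_and]
        intro h1 h2
        exact h0 (by rw [← h1 0 (Nat.zero_le _), ← h2 n le_rfl, add_zero])
      rw [hset, measure_empty, quenched_cyl ω (γ n) η, if_neg h0, zero_mul, mul_zero]
  have := congrArg (fun μ ↦ μ B) key
  simp only [Measure.smul_apply, smul_eq_mul] at this
  rwa [Measure.map_apply (measurable_tail n) hB,
    Measure.restrict_apply ((measurable_tail n) hB), Set.inter_comm] at this

end RWRE

namespace RWRE

/-! ### Events determined by an initial segment of the path -/

variable {d : ℕ}

/-- Membership in `E` only depends on the path up to time `n`. -/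
def DeterminedBy (n : ℕ) (E : Set (Path d)) : Prop :=
  ∀ X Y : Path d, (∀ i ≤ n, X i = Y i) → X ∈ E → Y ∈ E

/-- The path that starts with the finite segment `h` and then sits at the origin. -/
def extendPath (n : ℕ) (h : (i : Finset.Iic n) → (fun _ : ℕ ↦ Lattice d) i) : Path d :=
  fun i ↦ if hi : i ∈ Finset.Iic n then h ⟨i, hi⟩ else 0

lemma frestrictLe_extendPath (n : ℕ) (h : (i : Finset.Iic n) → (fun _ : ℕ ↦ Lattice d) i) :
    Preorder.frestrictLe (π := fun _ : ℕ ↦ Lattice d) n (extendPath n h) = h := by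
  ext1 ⟨i, hi⟩
  exact dif_pos hi

lemma DeterminedBy.measurableSet {n : ℕ} {E : Set (Path d)} (hE : DeterminedBy n E) :
    MeasurableSet E := by
  have : E = Preorder.frestrictLe (π := fun _ : ℕ ↦ Lattice d) n ⁻¹'
      (Preorder.frestrictLe (π := fun _ : ℕ ↦ Lattice d) n '' E) := by
    refine Set.Subset.antisymm (Set.subset_preimage_image _ _) ?_
    rintro X ⟨Y, hY, hXY⟩
    exact hE Y X (fun i hi ↦ congrFun hXY ⟨i, Finset.mem_Iic.2 hi⟩) hY
  rw [this]
  exact (Preorder.measurable_frestrictLe n) (Set.to_countable _).measurableSet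

lemma DeterminedBy.mono {n m : ℕ} (hnm : n ≤ m) {E : Set (Path d)} (hE : DeterminedBy n E) :
    DeterminedBy m E := fun X Y h ↦ hE X Y fun i hi ↦ h i (hi.trans hnm)

lemma DeterminedBy.inter {n : ℕ} {E F : Set (Path d)} (hE : DeterminedBy n E)
    (hF : DeterminedBy n F) : DeterminedBy n (E ∩ F) :=
  fun X Y h hX ↦ ⟨hE X Y h hX.1, hF X Y h hX.2⟩

lemma determinedBy_cyl (γ : Path d) (n : ℕ) : DeterminedBy n (cyl γ n) :=
  fun _ _ h hX i hi ↦ (h i hi).symm.trans (hX i hi)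

lemma determinedBy_eval (n : ℕ) (y : Lattice d) : DeterminedBy n {X : Path d | X n = y} :=
  fun _ _ h hX ↦ (h n le_rfl).symm.trans hX

lemma DeterminedBy.cyl_inter {n : ℕ} {E : Set (Path d)} (hE : DeterminedBy n E) (γ : Path d)
    [Decidable (γ ∈ E)] : cyl γ n ∩ E = if γ ∈ E then cyl γ n else ∅ := by
  split_ifs with h
  · exact Set.inter_eq_left.2 fun X hX ↦ hE γ X (fun i hi ↦ (hX i hi).symm) h
  · exact Set.eq_empty_of_forall_notMem fun X hX ↦ h (hE X γ hX.1 hX.2)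

lemma measure_eq_tsum_cyl (μ : Measure (Path d)) (n : ℕ) {F : Set (Path d)}
    (hF : MeasurableSet F) : μ F = ∑' h, μ (cyl (extendPath n h) n ∩ F) := by
  have hU : F = ⋃ h, cyl (extendPath n h) n ∩ F := by
    rw [← Set.iUnion_inter, eq_comm, Set.inter_eq_right]
    intro X _
    refine Set.mem_iUnion.2 ⟨Preorder.frestrictLe (π := fun _ : ℕ ↦ Lattice d) n X, ?_⟩
    rw [cyl_eq_preimage, frestrictLe_extendPath]
    rfl
  conv_lhs => rw [hU]
  refine measure_iUnion (fun h h' hne ↦ Set.disjoint_left.2 fun X hX hX' ↦ hne ?_)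
    fun h ↦ (measurableSet_cyl _ _).inter hF
  have h1 := hX.1
  have h2 := hX'.1
  rw [cyl_eq_preimage, frestrictLe_extendPath] at h1 h2
  exact h1.symm.trans h2

/-- A product formula on the cylinders `cyl γ n` contained in `E` gives one on `E`. -/
lemma measure_inter_eq_of_cyl {n : ℕ} {E : Set (Path d)} (hE : DeterminedBy n E)
    {μ : Measure (Path d)} {F : Set (Path d)} (hF : MeasurableSet F) (c : ℝ≥0∞)
    (h : ∀ γ ∈ E, μ (cyl γ n ∩ F) = μ (cyl γ n) * c) : μ (E ∩ F) = μ E * c := by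
  classical
  rw [measure_eq_tsum_cyl μ n (hE.measurableSet.inter hF),
    measure_eq_tsum_cyl μ n hE.measurableSet, ← ENNReal.tsum_mul_right]
  refine tsum_congr fun g ↦ ?_
  rw [← Set.inter_assoc, hE.cyl_inter]
  split_ifs with hg
  · exact h _ hg
  · simp

lemma stepLaw_congr {ω ω' : Env d} {x : Lattice d} (h : ω x = ω' x) :
    stepLaw ω x = stepLaw ω' x := by
  simp only [stepLaw, h]

/-- The event that the path stays above its starting level up to time `n`. -/
def noBacktrackUntil (d : ℕ) [NeZero d] (n : ℕ) : Set (Path d) := {X | ∀ i ≤ n, X 0 0 ≤ X i 0}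

section

variable [NeZero d]

lemma determinedBy_noBacktrackUntil (n : ℕ) : DeterminedBy n (noBacktrackUntil d n) :=
  fun X Y h hX i hi ↦ by rw [← h 0 (Nat.zero_le _), ← h i hi]; exact hX i hi

lemma noBacktrack_eq_iInter : noBacktrack d = ⋂ n, noBacktrackUntil d n := by
  ext X
  simp only [noBacktrack, noBacktrackUntil, Set.mem_iInter, Set.mem_ofPred_eq]
  exact ⟨fun h n i _ ↦ h i, fun h n ↦ h n n le_rfl⟩

lemma measurableSet_noBacktrack : MeasurableSet (noBacktrack d) := by
  rw [noBacktrack_eq_iInter]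
  exact MeasurableSet.iInter fun n ↦ (determinedBy_noBacktrackUntil n).measurableSet

/-! ### Dependence of the quenched law on the environment -/

/-- On the event of no backtracking, the quenched law only depends on the environment at or above
the starting level. -/
lemma quenched_noBacktrack_congr {ω ω' : Env d} {x : Lattice d}
    (h : ∀ y, x 0 ≤ y 0 → ω y = ω' y) {B : Set (Path d)} (hB : MeasurableSet B) :
    quenched ω x (B ∩ noBacktrack d) = quenched ω' x (B ∩ noBacktrack d) := by
  classical
  have hfin : ∀ (n : ℕ) (E : Set (Path d)), DeterminedBy n E → E ⊆ noBacktrackUntil d n →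
      quenched ω x E = quenched ω' x E := by
    intro n E hE hsub
    rw [measure_eq_tsum_cyl _ n hE.measurableSet, measure_eq_tsum_cyl _ n hE.measurableSet]
    refine tsum_congr fun g ↦ ?_
    rw [hE.cyl_inter]
    split_ifs with hg
    · rw [quenched_cyl, quenched_cyl]
      split_ifs with h0
      · congr 1
        refine Finset.prod_congr rfl fun i hi ↦ ?_
        rw [stepLaw_congr (h _ _)]
        have := hsub hg i (Finset.mem_range.1 hi).le
        rwa [h0] at this
      · simp
    · simp
  have hres : (quenched ω x).restrict (noBacktrack d) =
      (quenched ω' x).restrict (noBacktrack d) := by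
    refine ext_of_cyl fun γ n ↦ ?_
    rw [Measure.restrict_apply (measurableSet_cyl _ _), Measure.restrict_apply
      (measurableSet_cyl _ _)]
    have hI : cyl γ n ∩ noBacktrack d = ⋂ m, cyl γ n ∩ noBacktrackUntil d (n + m) := by
      rw [← Set.inter_iInter, noBacktrack_eq_iInter]
      congr 1
      ext X
      simp only [noBacktrackUntil, Set.mem_iInter, Set.mem_ofPred_eq]
      exact ⟨fun h m i hi ↦ h _ i hi, fun h m i hi ↦ h m i (by lia)⟩
    have hdet : ∀ m, DeterminedBy (n + m) (cyl γ n ∩ noBacktrackUntil d (n + m)) := fun m ↦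
      ((determinedBy_cyl γ n).mono (by lia)).inter (determinedBy_noBacktrackUntil _)
    have hanti : Antitone fun m ↦ cyl γ n ∩ noBacktrackUntil d (n + m) := by
      intro a b hab X hX
      exact ⟨hX.1, fun i hi ↦ hX.2 i (by lia)⟩
    have lim : ∀ ω'' : Env d, Tendsto
        (fun m ↦ quenched ω'' x (cyl γ n ∩ noBacktrackUntil d (n + m))) atTop
        (𝓝 (quenched ω'' x (cyl γ n ∩ noBacktrack d))) := by
      intro ω''
      rw [hI]
      exact tendsto_measure_iInter_atTop (fun m ↦ (hdet m).measurableSet.nullMeasurableSet)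
        hanti ⟨0, measure_ne_top _ _⟩
    refine tendsto_nhds_unique (lim ω) ?_
    convert lim ω' using 2 with m
    exact hfin _ _ (hdet m) Set.inter_subset_right
  have := congrArg (fun μ ↦ μ B) hres
  rwa [Measure.restrict_apply hB, Measure.restrict_apply hB] at this

end

/-! ### Independence of disjoint parts of the environment -/

/-- Functions of the environment on complementary sets of sites are independent. -/
lemma lintegral_envLaw_mul (Q : Measure (SiteLaw d)) [IsProbabilityMeasure Q]
    {f g : Env d → ℝ≥0∞} (hf : Measurable f) (hg : Measurable g) (S : Set (Lattice d))
    (hfS : ∀ ω ω' : Env d, (∀ y ∈ S, ω y = ω' y) → f ω = f ω')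
    (hgS : ∀ ω ω' : Env d, (∀ y ∈ Sᶜ, ω y = ω' y) → g ω = g ω') :
    ∫⁻ ω, f ω * g ω ∂(envLaw Q) = (∫⁻ ω, f ω ∂(envLaw Q)) * ∫⁻ ω, g ω ∂(envLaw Q) := by
  classical
  let m : Lattice d → MeasurableSpace (Env d) := fun y ↦
    MeasurableSpace.comap (fun ω ↦ ω y) inferInstance
  have hm : ∀ y, m y ≤ MeasurableSpace.pi := fun y ↦ (measurable_pi_apply y).comap_le
  have hind : iIndep m (envLaw Q) :=
    iIndepFun_infinitePi (P := fun _ : Lattice d ↦ Q) (X := fun _ p ↦ p) (fun _ ↦ measurable_id)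
  have hI := indep_iSup_of_disjoint hm hind (disjoint_compl_right : Disjoint S Sᶜ)
  -- A function of the coordinates in `T` factors through resetting the other coordinates.
  have hmeas : ∀ (T : Set (Lattice d)) (F : Env d → ℝ≥0∞), Measurable F →
      (∀ ω ω' : Env d, (∀ y ∈ T, ω y = ω' y) → F ω = F ω') →
      Measurable[⨆ y ∈ T, m y] F := by
    intro T F hF hT
    obtain ⟨ω₀⟩ : Nonempty (Env d) := by
      by_contra hne
      rw [not_nonempty_iff] at hne
      have := (inferInstance : IsProbabilityMeasure (envLaw Q)).measure_univ
      rw [Set.univ_eq_empty_iff.2 hne, measure_empty] at this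
      exact zero_ne_one this
    let r : Env d → Env d := fun ω y ↦ if y ∈ T then ω y else ω₀ y
    have hr : Measurable[⨆ y ∈ T, m y] r := by
      refine @measurable_pi_lambda _ _ _ (⨆ y ∈ T, m y) _ _ fun y ↦ ?_
      by_cases hy : y ∈ T
      · simp only [r, hy, if_true]
        exact (comap_measurable fun ω : Env d ↦ ω y).mono (le_iSup₂ (f := fun y _ ↦ m y) y hy)
          le_rfl
      · simp only [r, hy, if_false]
        exact measurable_const
    have : F = F ∘ r := by
      funext ω
      exact hT _ _ fun y hy ↦ by simp [r, hy]
    rw [this]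
    exact hF.comp hr
  exact lintegral_mul_eq_lintegral_mul_lintegral_of_independent_measurableSpace
    (iSup₂_le fun y _ ↦ hm y) (iSup₂_le fun y _ ↦ hm y) hI (hmeas S f hf hfS) (hmeas Sᶜ g hg hgS)

lemma annealed_apply (Q : Measure (SiteLaw d)) [IsProbabilityMeasure Q] (x : Lattice d)
    {B : Set (Path d)} (hB : MeasurableSet B) :
    annealed Q x B = ∫⁻ ω, quenched ω x B ∂(envLaw Q) :=
  Measure.bind_apply hB (quenchedKernel x).measurable.aemeasurable

lemma measurable_quenched_apply (x : Lattice d) {B : Set (Path d)} (hB : MeasurableSet B) :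
    Measurable fun ω : Env d ↦ quenched ω x B :=
  (Measure.measurable_coe hB).comp (measurable_quenched x)

/-- `n` is a strict record time of the level of the path. -/
def recordAt (d : ℕ) [NeZero d] (n : ℕ) : Set (Path d) := {X | ∀ i < n, X i 0 < X n 0}

section

variable [NeZero d] (Q : Measure (SiteLaw d)) [IsProbabilityMeasure Q]

lemma determinedBy_recordAt (n : ℕ) : DeterminedBy n (recordAt d n) :=
  fun X Y h hX i hi ↦ by rw [← h i hi.le, ← h n le_rfl]; exact hX i hi

/-- The renewal property: if the path up to time `n` ends at a strict record, its part after time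
`n` uses fresh sites of the environment as long as it does not backtrack. -/
lemma annealed_inter_tail (x y : Lattice d) {n : ℕ} {E : Set (Path d)} (hE : DeterminedBy n E)
    (hrec : E ⊆ recordAt d n) {B : Set (Path d)} (hB : MeasurableSet B) :
    annealed Q x ((E ∩ {X | X n = y}) ∩ tail n ⁻¹' (B ∩ noBacktrack d)) =
      annealed Q x (E ∩ {X | X n = y}) * annealed Q y (B ∩ noBacktrack d) := by
  have hBD := hB.inter (measurableSet_noBacktrack (d := d))
  refine measure_inter_eq_of_cyl (hE.inter (determinedBy_eval n y)) (measurable_tail n hBD) _ ?_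
  rintro γ ⟨hγE, hγy : γ n = y⟩
  rw [annealed_apply Q x ((measurableSet_cyl γ n).inter (measurable_tail n hBD)),
    annealed_apply Q x (measurableSet_cyl γ n), annealed_apply Q y hBD]
  simp_rw [quenched_cyl_inter_tail _ x γ n hBD, hγy]
  refine lintegral_envLaw_mul Q (measurable_quenched_apply x (measurableSet_cyl γ n))
    (measurable_quenched_apply y hBD) {z | z 0 < y 0} (fun ω ω' h ↦ ?_) (fun ω ω' h ↦ ?_)
  · rw [quenched_cyl, quenched_cyl]
    congr 1
    refine Finset.prod_congr rfl fun i hi ↦ ?_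
    have h1 : γ i 0 < γ n 0 := hrec hγE i (Finset.mem_range.1 hi)
    rw [hγy] at h1
    rw [stepLaw_congr (h _ h1)]
  · exact quenched_noBacktrack_congr (fun z hz ↦ h z (not_lt.2 hz)) hB

end

/-! ### Translation invariance -/

lemma stepLaw_add (ω : Env d) (x y w : Lattice d) :
    stepLaw ω (x + y) {w + y} = stepLaw (fun z ↦ ω (z + y)) x {w} := by
  simp only [stepLaw, Measure.coe_finsetSum, Finset.sum_apply, Measure.smul_apply]
  refine Finset.sum_congr rfl fun e _ ↦ ?_
  congr 1
  rw [Measure.dirac_apply, Measure.dirac_apply, Set.indicator_apply, Set.indicator_apply]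
  simp only [Set.mem_singleton_iff, add_right_comm x y, add_left_inj, Pi.one_apply]

lemma measurable_path_add (y : Lattice d) : Measurable fun (X : Path d) i ↦ X i + y :=
  measurable_pi_lambda _ fun i ↦
    (measurable_of_countable fun z : Lattice d ↦ z + y).comp (measurable_pi_apply i)

lemma quenched_add (ω : Env d) (x y : Lattice d) :
    quenched ω (x + y) = (quenched (fun z ↦ ω (z + y)) x).map fun (X : Path d) i ↦ X i + y := by
  refine ext_of_cyl fun γ n ↦ ?_
  rw [Measure.map_apply (measurable_path_add y) (measurableSet_cyl γ n)]
  have : (fun (X : Path d) i ↦ X i + y) ⁻¹' cyl γ n = cyl (fun i ↦ γ i - y) n := by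
    ext X
    simp only [cyl, Set.mem_preimage, Set.mem_ofPred_eq, eq_sub_iff_add_eq]
  rw [this, quenched_cyl, quenched_cyl]
  congr 1
  · simp only [sub_eq_iff_eq_add]
  · refine Finset.prod_congr rfl fun i _ ↦ ?_
    rw [← stepLaw_add, sub_add_cancel, sub_add_cancel]

lemma map_shift_envLaw (Q : Measure (SiteLaw d)) [IsProbabilityMeasure Q] (y : Lattice d) :
    (envLaw Q).map (fun ω z ↦ ω (z + y)) = envLaw Q :=
  Measure.map_infinitePi_infinitePi_of_inj (f := fun z : Lattice d ↦ z + y)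
    (add_left_injective y)

/-- The annealed law is translation invariant. -/
lemma annealed_add (Q : Measure (SiteLaw d)) [IsProbabilityMeasure Q] (x y : Lattice d) :
    annealed Q (x + y) = (annealed Q x).map fun (X : Path d) i ↦ X i + y := by
  refine Measure.ext fun B hB ↦ ?_
  have hB' := measurable_path_add y hB
  have hsh : Measurable fun (ω : Env d) z ↦ ω (z + y) :=
    measurable_pi_lambda _ fun z ↦ measurable_pi_apply (z + y)
  rw [Measure.map_apply (measurable_path_add y) hB, annealed_apply Q _ hB, annealed_apply Q _ hB']
  conv_rhs => rw [← map_shift_envLaw Q y, lintegral_map (measurable_quenched_apply x hB') hsh]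
  refine lintegral_congr fun ω ↦ ?_
  rw [quenched_add, Measure.map_apply (measurable_path_add y) hB]

lemma annealed_eq_map (Q : Measure (SiteLaw d)) [IsProbabilityMeasure Q] (y : Lattice d) :
    annealed Q y = (annealed Q 0).map fun (X : Path d) i ↦ X i + y := by
  rw [← annealed_add, zero_add]

lemma annealed_noBacktrack [NeZero d] (Q : Measure (SiteLaw d)) [IsProbabilityMeasure Q]
    (y : Lattice d) : annealed Q y (noBacktrack d) = annealed Q 0 (noBacktrack d) := by
  rw [annealed_eq_map, Measure.map_apply (measurable_path_add y) measurableSet_noBacktrack]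
  congr 1
  ext X
  simp [noBacktrack]

end RWRE

namespace RWRE

/-! ### Nearest-neighbour steps and ellipticity -/

variable {d : ℕ} (Q : Measure (SiteLaw d)) [IsProbabilityMeasure Q]

lemma ae_annealed_of_quenched (x : Lattice d) {B : Set (Path d)} (hB : MeasurableSet B)
    (h : ∀ ω : Env d, quenched ω x B = 0) : annealed Q x B = 0 := by
  rw [annealed_apply Q x hB]
  simp [h]

lemma ae_start (x : Lattice d) : ∀ᵐ X ∂(annealed Q x), X 0 = x := by
  have hdet : DeterminedBy 0 {X : Path d | X 0 ≠ x} := fun X Y h hX ↦ by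
    simpa [← h 0 le_rfl] using hX
  refine ae_annealed_of_quenched Q x hdet.measurableSet fun ω ↦ ?_
  have := measure_inter_eq_of_cyl hdet (μ := quenched ω x) MeasurableSet.univ 0 fun γ hγ ↦ ?_
  · rw [mul_zero, Set.inter_univ] at this
    exact this
  · rw [mul_zero, Set.inter_univ, quenched_cyl, if_neg hγ, zero_mul]

lemma stepLaw_eq_zero (ω : Env d) (x y : Lattice d) (h : ∀ e : Dir d, y ≠ x + e.vec) :
    stepLaw ω x {y} = 0 := by
  simp only [stepLaw, Measure.coe_finsetSum, Finset.sum_apply, Measure.smul_apply, smul_eq_mul]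
  refine Finset.sum_eq_zero fun e _ ↦ ?_
  rw [Measure.dirac_apply, Set.indicator_of_notMem fun h' ↦ h e h'.symm, mul_zero]

lemma ae_step (x : Lattice d) :
    ∀ᵐ X ∂(annealed Q x), ∀ n, ∃ e : Dir d, X (n + 1) = X n + e.vec := by
  rw [ae_all_iff]
  intro n
  have hdet : DeterminedBy (n + 1) {X : Path d | ¬ ∃ e : Dir d, X (n + 1) = X n + e.vec} :=
    fun X Y h hX ↦ by
      rw [Set.mem_ofPred_eq, ← h (n + 1) le_rfl, ← h n (by lia)]; exact hX
  refine ae_annealed_of_quenched Q x hdet.measurableSet fun ω ↦ ?_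
  have := measure_inter_eq_of_cyl hdet (μ := quenched ω x) MeasurableSet.univ 0 fun γ hγ ↦ ?_
  · rw [mul_zero, Set.inter_univ] at this
    exact this
  · rw [mul_zero, Set.inter_univ, quenched_cyl, Finset.prod_range_succ,
      stepLaw_eq_zero _ _ _ fun e he ↦ hγ ⟨e, he⟩, mul_zero, mul_zero]

lemma norm_vec_le (e : Dir d) : ‖e.vec‖ ≤ 1 := by
  refine (pi_norm_le_iff_of_nonneg zero_le_one).2 fun i ↦ ?_
  unfold Dir.vec
  by_cases hi : i = e.1
  · subst hi
    rw [Pi.single_eq_same]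
    split_ifs <;> simp
  · rw [Pi.single_eq_of_ne hi]
    simp

lemma ae_norm_le (x : Lattice d) : ∀ᵐ X ∂(annealed Q x), ∀ n : ℕ, ‖X n - x‖ ≤ n := by
  filter_upwards [ae_start Q x, ae_step Q x] with X h0 hs n
  induction n with
  | zero => simp [h0]
  | succ n ih =>
    obtain ⟨e, he⟩ := hs n
    calc ‖X (n + 1) - x‖ = ‖(X n - x) + e.vec‖ := by rw [he]; congr 1; abel
      _ ≤ ‖X n - x‖ + ‖e.vec‖ := norm_add_le _ _
      _ ≤ n + 1 := add_le_add ih (norm_vec_le e)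
      _ = ((n + 1 : ℕ) : ℝ) := by push_cast; rfl

/-- Ellipticity bounds the annealed probability of a nearest-neighbour path from below. -/
lemma pow_le_annealed_cyl {κ : ℝ} (hQ : UniformlyElliptic κ Q) (γ : Path d) (n : ℕ)
    (hγ : ∀ i < n, ∃ e : Dir d, γ (i + 1) = γ i + e.vec) :
    ENNReal.ofReal κ ^ n ≤ annealed Q (γ 0) (cyl γ n) := by
  have hae : ∀ᵐ ω ∂(envLaw Q), ∀ (x : Lattice d) (e : Dir d), κ ≤ (ω x).1 e := by
    rw [ae_all_iff]; intro x
    rw [ae_all_iff]; intro e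
    have hQe : ∀ᵐ p ∂Q, κ ≤ p.1 e := by
      have := hQ e
      rw [ae_iff]
      simpa only [not_le] using this
    exact (measurePreserving_eval_infinitePi (fun _ : Lattice d ↦ Q) x).quasiMeasurePreserving.ae
      hQe
  rw [annealed_apply Q _ (measurableSet_cyl γ n)]
  calc ENNReal.ofReal κ ^ n = ∫⁻ _, ENNReal.ofReal κ ^ n ∂(envLaw Q) := by simp
    _ ≤ _ := by
      refine lintegral_mono_ae ?_
      filter_upwards [hae] with ω hω
      rw [quenched_cyl, if_pos rfl, one_mul, ← Finset.card_range n, ← Finset.prod_const,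
        Finset.card_range]
      refine Finset.prod_le_prod' fun i hi ↦ ?_
      obtain ⟨e, he⟩ := hγ i (Finset.mem_range.1 hi)
      simp only [stepLaw, Measure.coe_finsetSum, Finset.sum_apply, Measure.smul_apply,
        smul_eq_mul]
      refine le_trans ?_ (Finset.single_le_sum (fun _ _ ↦ zero_le) (Finset.mem_univ e))
      rw [he, Measure.dirac_apply_of_mem (Set.mem_singleton _), mul_one]
      exact ENNReal.ofReal_le_ofReal (hω _ e)

/-! ### Transience and existence of regeneration times -/

variable [NeZero d]

lemma ae_tendsto_atTop {v : EuclideanSpace ℝ (Fin d)} (hv : 0 < v 0)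
    (h : LawOfLargeNumbers Q v) :
    ∀ᵐ X ∂(annealed Q 0), Tendsto (fun n ↦ X n 0) atTop atTop := by
  filter_upwards [h] with X hX
  have h0 : Tendsto (fun n : ℕ ↦ (n : ℝ)⁻¹ * (X n 0 : ℝ)) atTop (𝓝 (v 0)) := by
    have hc : Continuous fun w : EuclideanSpace ℝ (Fin d) ↦ w 0 := by fun_prop
    exact (hc.tendsto v).comp hX
  have h1 := tendsto_natCast_atTop_atTop (R := ℝ).atTop_mul_pos hv h0
  rw [← tendsto_intCast_atTop_iff (R := ℝ)]
  refine h1.congr' ?_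
  filter_upwards [eventually_gt_atTop 0] with n hn
  have : (n : ℝ) ≠ 0 := by positivity
  field_simp

/-- A walk that is transient in direction `e_1` has a positive probability of never going below
its starting level. -/
lemma annealed_noBacktrack_ne_zero
    (htr : ∀ᵐ X ∂(annealed Q 0), Tendsto (fun n ↦ X n 0) atTop atTop) :
    annealed Q 0 (noBacktrack d) ≠ 0 := by
  intro h0
  have hD := measurableSet_noBacktrack (d := d)
  have h1 : ∀ᵐ ω ∂(envLaw Q), ∀ y : Lattice d, quenched ω y (noBacktrack d) = 0 := by
    rw [ae_all_iff]
    intro y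
    have := annealed_noBacktrack Q y
    rw [h0, annealed_apply Q y hD, lintegral_eq_zero_iff (measurable_quenched_apply y hD)] at this
    exact this
  have h2 : ∀ᵐ X ∂(annealed Q 0), ∀ n, tail n X ∉ noBacktrack d := by
    rw [ae_all_iff]
    intro n
    have hm : MeasurableSet (tail n ⁻¹' noBacktrack d) := measurable_tail n hD
    have : annealed Q 0 (tail n ⁻¹' noBacktrack d) = 0 := by
      rw [annealed_apply Q 0 hm, lintegral_eq_zero_iff (measurable_quenched_apply 0 hm)]
      filter_upwards [h1] with ω hω
      rw [measure_eq_tsum_cyl _ n hm]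
      simp [quenched_cyl_inter_tail _ _ _ _ hD, hω]
    exact measure_eq_zero_iff_ae_notMem.1 this
  have : ∀ᵐ _ ∂(annealed Q 0), False := by
    filter_upwards [htr, h2] with X hX hn
    rw [← Nat.cofinite_eq_atTop] at hX
    obtain ⟨n, hmin⟩ := hX.exists_forall_le
    exact hn n fun i ↦ hmin _
  exact this.exists.elim fun _ h ↦ h

lemma measurableSet_isRegenerationTime (t : ℕ) :
    MeasurableSet {X : Path d | IsRegenerationTime X t} := by
  have hm : ∀ s, Measurable fun X : Path d ↦ X s 0 := fun s ↦
    (measurable_pi_apply 0).comp (measurable_pi_apply s)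
  have : {X : Path d | IsRegenerationTime X t} =
      (⋂ s, {X | s < t → X s 0 < X t 0}) ∩ ⋂ s, {X | t < s → X t 0 ≤ X s 0} := by
    ext X
    simp [IsRegenerationTime]
  rw [this]
  refine (MeasurableSet.iInter fun s ↦ ?_).inter (MeasurableSet.iInter fun s ↦ ?_)
  · by_cases hs : s < t
    · simpa [hs] using measurableSet_lt (hm s) (hm t)
    · simp [hs]
  · by_cases hs : t < s
    · simpa [hs] using measurableSet_le (hm t) (hm s)
    · simp [hs]

omit [NeZero d] in
lemma exists_determinedBy_approx (μ : Measure (Path d)) [IsFiniteMeasure μ] {B : Set (Path d)}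
    (hB : MeasurableSet B) {ε : ℝ≥0∞} (hε : 0 < ε) :
    ∃ n G, DeterminedBy n G ∧ μ (symmDiff G B) < ε := by
  obtain ⟨G, hG, hGB⟩ := exists_measure_symmDiff_lt_of_generateFrom_isSetRing (μ := μ)
    (isSetAlgebra_measurableCylinders (α := fun _ : ℕ ↦ Lattice d)).isSetRing
    ⟨{Set.univ}, Set.countable_singleton _, by
      rw [Set.singleton_subset_iff]; exact univ_mem_measurableCylinders _, by simp⟩
    (generateFrom_measurableCylinders (α := fun _ : ℕ ↦ Lattice d)).symm hB hε
  rw [measurableCylinders_nat] at hG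
  simp only [Set.mem_iUnion, Set.mem_singleton_iff] at hG
  obtain ⟨n, S, -, rfl⟩ := hG
  refine ⟨n, _, fun X Y h hX ↦ ?_, hGB⟩
  have : Preorder.frestrictLe (π := fun _ : ℕ ↦ Lattice d) n X =
      Preorder.frestrictLe (π := fun _ : ℕ ↦ Lattice d) n Y := by
    ext1 ⟨i, hi⟩
    exact h i (Finset.mem_Iic.1 hi)
  change Preorder.frestrictLe (π := fun _ : ℕ ↦ Lattice d) n Y ∈ S
  rw [← this]
  exact hX

/-- The first time at which the level reaches `k` is `t`. -/
def firstPassage (d : ℕ) [NeZero d] (k : ℤ) (t : ℕ) : Set (Path d) :=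
  {X | (∀ i < t, X i 0 < k) ∧ k ≤ X t 0}

lemma determinedBy_firstPassage (k : ℤ) (t : ℕ) : DeterminedBy t (firstPassage d k t) :=
  fun X Y h hX ↦ ⟨fun i hi ↦ by rw [← h i hi.le]; exact hX.1 i hi,
    by rw [← h t le_rfl]; exact hX.2⟩

lemma annealed_inter_tail_of_const (x : Lattice d) {n : ℕ} {E : Set (Path d)}
    (hE : DeterminedBy n E) (hrec : E ⊆ recordAt d n) {B : Set (Path d)} (hB : MeasurableSet B)
    {c : ℝ≥0∞} (hc : ∀ y, annealed Q y (B ∩ noBacktrack d) = c) :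
    annealed Q x (E ∩ tail n ⁻¹' (B ∩ noBacktrack d)) = annealed Q x E * c := by
  refine measure_inter_eq_of_cyl hE
    (measurable_tail n (hB.inter measurableSet_noBacktrack)) _ fun γ hγ ↦ ?_
  have hsub : cyl γ n ⊆ E := fun X hX ↦ hE γ X (fun i hi ↦ (hX i hi).symm) hγ
  have := annealed_inter_tail Q x (γ n) (determinedBy_cyl γ n) (hsub.trans hrec) hB
  have hn : cyl γ n ⊆ {X | X n = γ n} := fun X hX ↦ hX n le_rfl
  rwa [hc, Set.inter_eq_left.2 hn] at this

lemma annealed_inter_tail_noBacktrack (x : Lattice d) {n : ℕ} {E : Set (Path d)}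
    (hE : DeterminedBy n E) (hrec : E ⊆ recordAt d n) :
    annealed Q x (E ∩ tail n ⁻¹' noBacktrack d) =
      annealed Q x E * annealed Q 0 (noBacktrack d) := by
  have := annealed_inter_tail_of_const Q x hE hrec MeasurableSet.univ
    (c := annealed Q 0 (noBacktrack d)) fun y ↦ by rw [Set.univ_inter, annealed_noBacktrack]
  rwa [Set.univ_inter] at this

/-- Whatever the path does up to time `N`, with probability at least `P(D)` the first passage at a
level that it has not reached yet is a regeneration time. -/
lemma mul_le_annealed_regeneration
    (htr : ∀ᵐ X ∂(annealed Q 0), Tendsto (fun n ↦ X n 0) atTop atTop) {N : ℕ} {G : Set (Path d)}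
    (hG : DeterminedBy N G) :
    annealed Q 0 G * annealed Q 0 (noBacktrack d) ≤
      annealed Q 0 (G ∩ {X | ∃ t ≥ N, IsRegenerationTime X t}) := by
  classical
  have hR : MeasurableSet {X : Path d | ∃ t ≥ N, IsRegenerationTime X t} := by
    have : {X : Path d | ∃ t ≥ N, IsRegenerationTime X t} =
        ⋃ t, ⋃ _ : t ≥ N, {X | IsRegenerationTime X t} := by
      ext X; simp
    rw [this]
    exact MeasurableSet.iUnion fun t ↦ MeasurableSet.iUnion fun _ ↦
      measurableSet_isRegenerationTime t
  have hcyl : ∀ γ : Path d, annealed Q 0 (cyl γ N) * annealed Q 0 (noBacktrack d) ≤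
      annealed Q 0 (cyl γ N ∩ {X | ∃ t ≥ N, IsRegenerationTime X t}) := by
    intro γ
    obtain ⟨k, hk⟩ : ∃ k : ℤ, ∀ i ≤ N, γ i 0 < k := by
      obtain ⟨M, hM⟩ := ((Finset.range (N + 1)).image fun i ↦ γ i 0).bddAbove
      refine ⟨M + 1, fun i hi ↦ Int.lt_add_one_of_le (hM ?_)⟩
      exact Finset.mem_coe.2 (Finset.mem_image.2 ⟨i, Finset.mem_range.2 (by lia), rfl⟩)
    let E : ℕ → Set (Path d) := fun t ↦ cyl γ N ∩ firstPassage d k (N + t)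
    have hE : ∀ t, DeterminedBy (N + t) (E t) := fun t ↦
      ((determinedBy_cyl γ N).mono (by lia)).inter (determinedBy_firstPassage k _)
    have hErec : ∀ t, E t ⊆ recordAt d (N + t) := fun t X hX i hi ↦
      (hX.2.1 i hi).trans_le hX.2.2
    have hdisj : Pairwise (Function.onFun Disjoint E) := by
      intro s t hst
      refine Set.disjoint_left.2 fun X hs ht ↦ ?_
      rcases lt_or_gt_of_ne hst with h | h
      · exact absurd (ht.2.1 (N + s) (by lia)) (not_lt.2 hs.2.2)
      · exact absurd (hs.2.1 (N + t) (by lia)) (not_lt.2 ht.2.2)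
    have hmass : annealed Q 0 (cyl γ N) ≤ ∑' t, annealed Q 0 (E t) := by
      rw [← measure_iUnion hdisj fun t ↦ (hE t).measurableSet]
      refine measure_mono_ae ?_
      filter_upwards [htr] with X hX hXγ
      have hex : ∃ t, k ≤ X t 0 := (hX.eventually_ge_atTop k).exists
      have hN : N ≤ Nat.find hex := by
        refine (Nat.le_find_iff hex N).2 fun i hi ↦ not_le.2 ?_
        rw [hXγ i hi.le]
        exact hk i hi.le
      refine Set.mem_iUnion.2 ⟨Nat.find hex - N, hXγ, fun i hi ↦ ?_, ?_⟩
      · rw [Nat.add_sub_cancel' hN] at hi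
        exact not_le.1 (Nat.find_min hex hi)
      · rw [Nat.add_sub_cancel' hN]
        exact Nat.find_spec hex
    calc annealed Q 0 (cyl γ N) * annealed Q 0 (noBacktrack d)
        ≤ (∑' t, annealed Q 0 (E t)) * annealed Q 0 (noBacktrack d) := by gcongr
      _ = ∑' t, annealed Q 0 (E t ∩ tail (N + t) ⁻¹' noBacktrack d) := by
        rw [← ENNReal.tsum_mul_right]
        exact tsum_congr fun t ↦ (annealed_inter_tail_noBacktrack Q 0 (hE t) (hErec t)).symm
      _ = annealed Q 0 (⋃ t, E t ∩ tail (N + t) ⁻¹' noBacktrack d) :=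
        (measure_iUnion (fun s t hst ↦ (hdisj hst).mono Set.inter_subset_left
          Set.inter_subset_left) fun t ↦ (hE t).measurableSet.inter
            (measurable_tail _ measurableSet_noBacktrack)).symm
      _ ≤ _ := by
        refine measure_mono (Set.iUnion_subset fun t X hX ↦ ⟨hX.1.1, N + t, by lia,
          hErec t hX.1, fun s hs ↦ ?_⟩)
        have := hX.2 (s - (N + t))
        simpa [tail, show N + t + (s - (N + t)) = s by lia] using this
  rw [measure_eq_tsum_cyl _ N hG.measurableSet, measure_eq_tsum_cyl _ N
    (hG.measurableSet.inter hR), ← ENNReal.tsum_mul_right]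
  refine ENNReal.tsum_le_tsum fun g ↦ ?_
  rw [← Set.inter_assoc, hG.cyl_inter]
  split_ifs
  · exact hcyl _
  · simp

/-- Under transience, there are almost surely infinitely many regeneration times. -/
lemma ae_infinitely_many_regenerations
    (htr : ∀ᵐ X ∂(annealed Q 0), Tendsto (fun n ↦ X n 0) atTop atTop) :
    ∀ᵐ X ∂(annealed Q 0), ∀ L, ∃ t ≥ L, IsRegenerationTime X t := by
  rw [ae_all_iff]
  intro L
  set B : Set (Path d) := {X | ¬ ∃ t ≥ L, IsRegenerationTime X t} with hBdef
  set p := annealed Q 0 (noBacktrack d) with hp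
  have hp0 : p ≠ 0 := annealed_noBacktrack_ne_zero Q htr
  have hB : MeasurableSet B := by
    have : B = ⋂ t, ⋂ _ : t ≥ L, {X | IsRegenerationTime X t}ᶜ := by
      ext X; simp [hBdef]
    rw [this]
    exact MeasurableSet.iInter fun t ↦ MeasurableSet.iInter fun _ ↦
      (measurableSet_isRegenerationTime t).compl
  have hbound : ∀ ε : ℝ≥0∞, 0 < ε → annealed Q 0 B * p ≤ ε + ε := by
    intro ε hε
    obtain ⟨n, G, hG, hGB⟩ := exists_determinedBy_approx (annealed Q 0) hB hε
    have hG' : DeterminedBy (max n L) G := hG.mono (le_max_left _ _)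
    have h1 : annealed Q 0 B ≤ annealed Q 0 G + ε := by
      calc annealed Q 0 B ≤ annealed Q 0 (G ∪ symmDiff G B) := by
            refine measure_mono fun X hX ↦ ?_
            by_cases hXG : X ∈ G
            · exact Or.inl hXG
            · exact Or.inr (Or.inr ⟨hX, hXG⟩)
        _ ≤ _ := (measure_union_le _ _).trans (by gcongr)
    have h2 : annealed Q 0 G * p ≤ ε := by
      refine (mul_le_annealed_regeneration Q htr hG').trans (le_trans (measure_mono ?_) hGB.le)
      rintro X ⟨hXG, t, ht, hreg⟩
      exact Or.inl ⟨hXG, fun hXB ↦ hXB ⟨t, le_trans (le_max_right _ _) ht, hreg⟩⟩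
    calc annealed Q 0 B * p ≤ (annealed Q 0 G + ε) * p := by gcongr
      _ = annealed Q 0 G * p + ε * p := add_mul _ _ _
      _ ≤ ε + ε * 1 := by gcongr; exact prob_le_one
      _ = ε + ε := by rw [mul_one]
  have hzero : annealed Q 0 B * p = 0 := by
    by_contra hne
    have hfin : annealed Q 0 B * p ≠ ∞ := ENNReal.mul_ne_top (measure_ne_top _ _)
      (measure_ne_top _ _)
    have h2 := ENNReal.half_pos hne
    have := hbound (annealed Q 0 B * p / 2 / 2) (ENNReal.half_pos h2.ne')
    rw [ENNReal.add_halves] at this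
    exact absurd this (not_le.2 (ENNReal.half_lt_self hne hfin))
  rcases mul_eq_zero.1 hzero with h | h
  · exact h
  · exact absurd h hp0

end RWRE

namespace RWRE

/-! ### The renewal structure -/

section paths

variable {d : ℕ} [NeZero d]

/-- `t` looks like a regeneration time when only the path up to time `n` is inspected. -/
def IsRegenerationWithin (X : Path d) (t n : ℕ) : Prop :=
  (∀ s < t, X s 0 < X t 0) ∧ ∀ s, t < s → s ≤ n → X t 0 ≤ X s 0

/-- The event that `n` is the first candidate for a regeneration time. -/
def firstRegenerationEvent (d : ℕ) [NeZero d] (n : ℕ) : Set (Path d) :=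
  recordAt d n ∩ {X | ∀ t < n, ¬ IsRegenerationWithin X t n}

/-- The event that the path up to time `n` is a regeneration cycle: it starts at its lowest level,
ends at a strict record, and has no regeneration time in between. -/
def cycleEvent (d : ℕ) [NeZero d] (n : ℕ) : Set (Path d) :=
  noBacktrackUntil d n ∩ recordAt d n ∩
    {X | 0 < n ∧ ∀ t, 0 < t → t < n → ¬ IsRegenerationWithin X t n}

lemma IsRegenerationWithin.congr {X Y : Path d} {t n : ℕ} (htn : t ≤ n)
    (h : ∀ i ≤ n, X i = Y i) (hX : IsRegenerationWithin X t n) : IsRegenerationWithin Y t n :=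
  ⟨fun s hs ↦ by rw [← h s (by lia), ← h t htn]; exact hX.1 s hs,
    fun s hs hsn ↦ by rw [← h s hsn, ← h t htn]; exact hX.2 s hs hsn⟩

lemma determinedBy_firstRegenerationEvent (n : ℕ) :
    DeterminedBy n (firstRegenerationEvent d n) :=
  (determinedBy_recordAt n).inter fun _ _ h hX t ht hr ↦
    hX t ht (hr.congr ht.le fun i hi ↦ (h i hi).symm)

lemma determinedBy_cycleEvent (n : ℕ) : DeterminedBy n (cycleEvent d n) :=
  ((determinedBy_noBacktrackUntil n).inter (determinedBy_recordAt n)).inter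
    fun _ _ h hX ↦ ⟨hX.1, fun t ht htn hr ↦
      hX.2 t ht htn (hr.congr htn.le fun i hi ↦ (h i hi).symm)⟩

lemma isRegenerationTime_iff {X : Path d} {t : ℕ} :
    IsRegenerationTime X t ↔ X ∈ recordAt d t ∧ tail t X ∈ noBacktrack d := by
  refine and_congr Iff.rfl ⟨fun h i ↦ ?_, fun h s hs ↦ ?_⟩
  · rcases Nat.eq_zero_or_pos i with rfl | hi
    · exact le_rfl
    · exact h (t + i) (by lia)
  · have := h (s - t)
    simpa [tail, show t + (s - t) = s by lia] using this

lemma IsRegenerationTime.within {X : Path d} {t : ℕ} (h : IsRegenerationTime X t)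
    (n : ℕ) : IsRegenerationWithin X t n := ⟨h.1, fun s hs _ ↦ h.2 s hs⟩

lemma IsRegenerationWithin.isRegenerationTime {X : Path d} {t n : ℕ}
    (h : IsRegenerationWithin X t n) (htn : t ≤ n) (hn : tail n X ∈ noBacktrack d) :
    IsRegenerationTime X t := by
  refine ⟨h.1, fun s hs ↦ ?_⟩
  by_cases hsn : s ≤ n
  · exact h.2 s hs hsn
  · have h1 : X n 0 ≤ X s 0 := by
      have := hn (s - n)
      simpa [tail, show n + (s - n) = s by lia] using this
    refine le_trans ?_ h1
    rcases htn.eq_or_lt with rfl | htn'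
    · exact le_rfl
    · exact h.2 n htn' le_rfl

lemma exists_mem_firstRegenerationEvent {X : Path d} (h : ∃ t, IsRegenerationTime X t) :
    ∃ n, X ∈ firstRegenerationEvent d n ∩ tail n ⁻¹' noBacktrack d := by
  classical
  have hs := isRegenerationTime_iff.1 (Nat.find_spec h)
  exact ⟨Nat.find h, ⟨hs.1, fun t ht hr ↦
    Nat.find_min h ht (hr.isRegenerationTime ht.le hs.2)⟩, hs.2⟩

lemma exists_mem_cycleEvent {X : Path d} (hX : X ∈ noBacktrack d)
    (h : ∃ t, 1 ≤ t ∧ IsRegenerationTime X t) :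
    ∃ n, X ∈ cycleEvent d n ∩ tail n ⁻¹' noBacktrack d := by
  classical
  have hs := isRegenerationTime_iff.1 (Nat.find_spec h).2
  exact ⟨Nat.find h, ⟨⟨fun i _ ↦ hX i, hs.1⟩, (Nat.find_spec h).1, fun t ht htn hr ↦
    Nat.find_min h htn ⟨ht, hr.isRegenerationTime htn.le hs.2⟩⟩, hs.2⟩

lemma mem_noBacktrack_of_cycleEvent {X : Path d} {n : ℕ} (h : X ∈ cycleEvent d n)
    (hn : tail n X ∈ noBacktrack d) : X ∈ noBacktrack d := by
  intro i
  by_cases hi : i ≤ n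
  · exact h.1.1 i hi
  · have := hn (i - n)
    simp only [tail, add_zero, show n + (i - n) = i by lia] at this
    exact (h.1.1 n le_rfl).trans this

lemma disjoint_cycleEvent : Pairwise (Function.onFun Disjoint fun n ↦
    cycleEvent d n ∩ tail n ⁻¹' noBacktrack d) := by
  have key : ∀ (X : Path d) (n m : ℕ), n < m → X ∈ cycleEvent d n ∩ tail n ⁻¹' noBacktrack d →
      X ∉ cycleEvent d m := fun X n m hnm hn hm ↦
    hm.2.2 n hn.1.2.1 hnm ((isRegenerationTime_iff.2 ⟨hn.1.1.2, hn.2⟩).within m)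
  intro n m hnm
  refine Set.disjoint_left.2 fun X hn hm ↦ ?_
  rcases lt_or_gt_of_ne hnm with h | h
  · exact key X n m h hn hm.1
  · exact key X m n h hm hn.1

lemma disjoint_firstRegenerationEvent : Pairwise (Function.onFun Disjoint fun n ↦
    firstRegenerationEvent d n ∩ tail n ⁻¹' noBacktrack d) := by
  have key : ∀ (X : Path d) (n m : ℕ), n < m →
      X ∈ firstRegenerationEvent d n ∩ tail n ⁻¹' noBacktrack d →
      X ∉ firstRegenerationEvent d m := fun X n m hnm hn hm ↦
    hm.2 n hnm ((isRegenerationTime_iff.2 ⟨hn.1.1, hn.2⟩).within m)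
  intro n m hnm
  refine Set.disjoint_left.2 fun X hn hm ↦ ?_
  rcases lt_or_gt_of_ne hnm with h | h
  · exact key X n m h hn hm.1
  · exact key X m n h hm hn.1

lemma regTime_eq {X : Path d} {k n : ℕ} (hk : X ∈ firstRegenerationEvent d k)
    (hn : tail k X ∈ cycleEvent d n) (ht : tail n (tail k X) ∈ noBacktrack d) :
    regTime X 0 = k ∧ regTime X 1 = k + n := by
  classical
  have hn0 : 0 < n := hn.2.1
  have hregk : IsRegenerationTime X k :=
    isRegenerationTime_iff.2 ⟨hk.1, mem_noBacktrack_of_cycleEvent hn ht⟩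
  have hkn : X k 0 < X (k + n) 0 := hn.1.2 0 hn0
  have hregn : IsRegenerationTime X (k + n) := by
    refine isRegenerationTime_iff.2 ⟨fun s hs ↦ ?_, fun i ↦ ?_⟩
    · by_cases hsk : s < k
      · exact (hk.1 s hsk).trans hkn
      · have := hn.1.2 (s - k) (by lia)
        simpa [tail, show k + (s - k) = s by lia] using this
    · have := ht i
      simpa [tail, add_assoc] using this
  have hlow : ∀ t < k, ¬ IsRegenerationTime X t := fun t ht hr ↦ hk.2 t ht (hr.within k)
  have hmid : ∀ t, k < t → t < k + n → ¬ IsRegenerationTime X t := by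
    intro t h1 h2 hr
    refine hn.2.2 (t - k) (by lia) (by lia) ⟨fun s hs ↦ ?_, fun s hs hsn ↦ ?_⟩
    · have := hr.1 (k + s) (by lia)
      simpa [tail, show k + (t - k) = t by lia] using this
    · have := hr.2 (k + s) (by lia)
      simpa [tail, show k + (t - k) = t by lia] using this
  constructor
  · have hc : Nat.count (IsRegenerationTime X) k = 0 := by
      rw [Nat.count_eq_card_filter_range, Finset.card_eq_zero]
      exact Finset.filter_eq_empty_iff.2 fun t ht ↦ hlow t (Finset.mem_range.1 ht)
    have := Nat.nth_count hregk
    rwa [hc] at this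
  · have hc : Nat.count (IsRegenerationTime X) (k + n) = 1 := by
      rw [Nat.count_eq_card_filter_range, Finset.card_eq_one]
      refine ⟨k, ?_⟩
      ext t
      simp only [Finset.mem_filter, Finset.mem_range, Finset.mem_singleton]
      constructor
      · rintro ⟨h1, h2⟩
        rcases lt_trichotomy t k with h | h | h
        · exact absurd h2 (hlow t h)
        · exact h
        · exact absurd h2 (hmid t h h1)
      · rintro rfl
        exact ⟨by lia, hregk⟩
    have := Nat.nth_count hregn
    rwa [hc] at this

end paths

variable {d : ℕ} [NeZero d] (Q : Measure (SiteLaw d)) [IsProbabilityMeasure Q]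

/-- The law of the displacement between consecutive regeneration times: the law of the end point of
a regeneration cycle from the origin. -/
noncomputable def renewalLaw : Measure (Lattice d) :=
  Measure.sum fun n ↦ ((annealed Q 0).restrict (cycleEvent d n)).map fun X ↦ X n

/-- The probability that a site is visited in a regeneration cycle from the origin, before the end
of the cycle. -/
noncomputable def cycleOccupation (x : Lattice d) : ℝ≥0∞ :=
  ∑' n, annealed Q 0 (cycleEvent d n ∩ {X | ∃ i < n, X i = x})

/-- The probability that the walk from the origin does not backtrack and visits `x`. -/
noncomputable def visitWeight (x : Lattice d) : ℝ≥0∞ :=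
  annealed Q 0 ({X | ∃ i, X i = x} ∩ noBacktrack d)

/-- The second moment of the duration of a regeneration cycle. -/
noncomputable def cycleSecondMoment : ℝ≥0∞ := ∑' n : ℕ, (n : ℝ≥0∞) ^ 2 * annealed Q 0 (cycleEvent d n)

omit [NeZero d] in
lemma measure_eq_tsum_eval (μ : Measure (Path d)) (n : ℕ) {F : Set (Path d)}
    (hF : MeasurableSet F) : μ F = ∑' y, μ (F ∩ {X | X n = y}) := by
  have hU : F = ⋃ y, F ∩ {X | X n = y} := by
    ext X; simp
  conv_lhs => rw [hU]
  refine measure_iUnion (fun y z hne ↦ Set.disjoint_left.2 fun X hX hX' ↦ hne ?_)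
    fun y ↦ hF.inter (determinedBy_eval n y).measurableSet
  exact (hX.2 : X n = y).symm.trans hX'.2

omit [NeZero d] in
lemma measurableSet_visit (x : Lattice d) : MeasurableSet {X : Path d | ∃ i, X i = x} := by
  have : {X : Path d | ∃ i, X i = x} = ⋃ i, {X | X i = x} := by ext X; simp
  rw [this]
  exact MeasurableSet.iUnion fun i ↦ (determinedBy_eval i x).measurableSet

lemma cycleEvent_subset_recordAt (n : ℕ) : cycleEvent d n ⊆ recordAt d n := fun _ h ↦ h.1.2

lemma lintegral_renewalLaw (f : Lattice d → ℝ≥0∞) :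
    ∫⁻ v, f v ∂(renewalLaw Q) =
      ∑' n, ∑' y, f y * annealed Q 0 (cycleEvent d n ∩ {X | X n = y}) := by
  rw [renewalLaw, lintegral_sum_measure]
  refine tsum_congr fun n ↦ ?_
  rw [lintegral_countable']
  refine tsum_congr fun y ↦ ?_
  rw [Measure.map_apply (measurable_pi_apply n) (measurableSet_singleton y),
    Measure.restrict_apply (measurable_pi_apply n (measurableSet_singleton y)), Set.inter_comm]
  rfl

lemma annealed_visit (x y : Lattice d) :
    annealed Q y ({X | ∃ i, X i = x} ∩ noBacktrack d) = visitWeight Q (x - y) := by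
  rw [annealed_eq_map, Measure.map_apply (measurable_path_add y)
    ((measurableSet_visit x).inter measurableSet_noBacktrack), visitWeight]
  congr 1
  ext X
  simp [noBacktrack, eq_sub_iff_add_eq]

section transient

variable (htr : ∀ᵐ X ∂(annealed Q 0), Tendsto (fun n ↦ X n 0) atTop atTop)

include htr

/-- Almost surely on the event of no backtracking, exactly one time ends the first cycle; the
factor `P(D)` of the walk after that time cancels. -/
lemma tsum_annealed_cycleEvent : ∑' n, annealed Q 0 (cycleEvent d n) = 1 := by
  have hp := annealed_noBacktrack_ne_zero Q htr
  have h : (∑' n, annealed Q 0 (cycleEvent d n)) * annealed Q 0 (noBacktrack d) =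
      1 * annealed Q 0 (noBacktrack d) := by
    rw [one_mul, ← ENNReal.tsum_mul_right]
    simp_rw [← annealed_inter_tail_noBacktrack Q 0 (determinedBy_cycleEvent _)
      (cycleEvent_subset_recordAt _)]
    rw [← measure_iUnion disjoint_cycleEvent fun n ↦ (determinedBy_cycleEvent n).measurableSet.inter
      (measurable_tail n measurableSet_noBacktrack)]
    refine measure_congr ?_
    filter_upwards [ae_infinitely_many_regenerations Q htr] with X hX
    refine propext ⟨fun h ↦ ?_, fun h ↦ ?_⟩
    · obtain ⟨n, hn⟩ := Set.mem_iUnion.1 h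
      exact mem_noBacktrack_of_cycleEvent hn.1 hn.2
    · exact Set.mem_iUnion.2 (exists_mem_cycleEvent h (hX 1))
  exact (ENNReal.mul_left_inj hp (measure_ne_top _ _)).1 h

lemma isProbabilityMeasure_renewalLaw : IsProbabilityMeasure (renewalLaw Q) := by
  constructor
  rw [← lintegral_one, lintegral_renewalLaw]
  refine Eq.trans (tsum_congr fun n ↦ ?_) (tsum_annealed_cycleEvent Q htr)
  simp only [one_mul]
  exact (measure_eq_tsum_eval _ n (determinedBy_cycleEvent n).measurableSet).symm

/-- The second moment of a cycle is at most that of the gap between the first two regeneration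
times of the unconditioned walk. -/
lemma cycleSecondMoment_le : cycleSecondMoment Q ≤ regGapMoment Q 2 := by
  classical
  set p := annealed Q 0 (noBacktrack d) with hp
  let W : ℕ × ℕ → Set (Path d) := fun i ↦ firstRegenerationEvent d i.1 ∩
    tail i.1 ⁻¹' ((cycleEvent d i.2 ∩ tail i.2 ⁻¹' noBacktrack d) ∩ noBacktrack d)
  have hcm : ∀ n, MeasurableSet (cycleEvent d n ∩ tail n ⁻¹' noBacktrack d) := fun n ↦
    (determinedBy_cycleEvent n).measurableSet.inter
      (measurable_tail n measurableSet_noBacktrack)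
  have hWm : ∀ i, MeasurableSet (W i) := fun i ↦
    (determinedBy_firstRegenerationEvent i.1).measurableSet.inter
      (measurable_tail i.1 ((hcm i.2).inter measurableSet_noBacktrack))
  have hreg : ∀ i, ∀ X ∈ W i, regTime X 0 = i.1 ∧ regTime X 1 = i.1 + i.2 := fun i X hX ↦
    regTime_eq hX.1 hX.2.1.1 hX.2.1.2
  have hconst : ∀ n y, annealed Q y ((cycleEvent d n ∩ tail n ⁻¹' noBacktrack d) ∩
      noBacktrack d) = annealed Q 0 (cycleEvent d n) * p := by
    intro n y
    rw [Set.inter_eq_left.2 fun X hX ↦ mem_noBacktrack_of_cycleEvent hX.1 hX.2,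
      ← annealed_inter_tail_noBacktrack Q 0 (determinedBy_cycleEvent n)
        (cycleEvent_subset_recordAt n), annealed_eq_map Q y,
      Measure.map_apply (measurable_path_add y) (hcm n)]
    congr 1
    ext X
    simp [cycleEvent, noBacktrackUntil, recordAt, IsRegenerationWithin, noBacktrack, tail]
  have hWmass : ∀ i, annealed Q 0 (W i) =
      annealed Q 0 (firstRegenerationEvent d i.1) * (annealed Q 0 (cycleEvent d i.2) * p) :=
    fun i ↦ annealed_inter_tail_of_const Q 0 (determinedBy_firstRegenerationEvent i.1)
      (fun X hX ↦ hX.1) (hcm i.2) (hconst i.2)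
  have hfirst : ∑' k, annealed Q 0 (firstRegenerationEvent d k) * p = 1 := by
    have hk : ∀ k, annealed Q 0 (firstRegenerationEvent d k) * p =
        annealed Q 0 (firstRegenerationEvent d k ∩ tail k ⁻¹' noBacktrack d) := fun k ↦
      (annealed_inter_tail_noBacktrack Q 0 (determinedBy_firstRegenerationEvent k)
        fun X hX ↦ hX.1).symm
    rw [tsum_congr hk, ← measure_iUnion disjoint_firstRegenerationEvent fun n ↦
      (determinedBy_firstRegenerationEvent n).measurableSet.inter
      (measurable_tail n measurableSet_noBacktrack), ← measure_univ (μ := annealed Q 0)]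
    refine measure_congr ?_
    filter_upwards [ae_infinitely_many_regenerations Q htr] with X hX
    refine propext ⟨fun _ ↦ trivial, fun _ ↦ Set.mem_iUnion.2 ?_⟩
    obtain ⟨t, -, ht⟩ := hX 0
    exact exists_mem_firstRegenerationEvent ⟨t, ht⟩
  have hpoint : ∀ X : Path d, ∑' i : ℕ × ℕ, (W i).indicator (fun _ ↦ (i.2 : ℝ≥0∞) ^ 2) X ≤
      ((regTime X 1 - regTime X 0 : ℕ) : ℝ≥0∞) ^ (2 : ℝ) := by
    intro X
    by_cases hX : ∃ i, X ∈ W i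
    · obtain ⟨i, hi⟩ := hX
      have hr := hreg i X hi
      rw [tsum_eq_single i]
      · rw [Set.indicator_of_mem hi, hr.1, hr.2, Nat.add_sub_cancel_left, ENNReal.rpow_two]
      · intro j hj
        refine Set.indicator_of_notMem (fun hXj ↦ hj ?_) _
        have hr' := hreg j X hXj
        exact Prod.ext (hr'.1.symm.trans hr.1) (by lia)
    · push Not at hX
      simp [Set.indicator_of_notMem (hX _)]
  calc cycleSecondMoment Q
      = ∑' k, ∑' n : ℕ, annealed Q 0 (firstRegenerationEvent d k) * p *
          ((n : ℝ≥0∞) ^ 2 * annealed Q 0 (cycleEvent d n)) := by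
        simp_rw [ENNReal.tsum_mul_left]
        rw [ENNReal.tsum_mul_right, hfirst, one_mul, cycleSecondMoment]
    _ = ∑' i : ℕ × ℕ, (i.2 : ℝ≥0∞) ^ 2 * annealed Q 0 (W i) := by
        rw [ENNReal.tsum_prod']
        refine tsum_congr fun k ↦ tsum_congr fun n ↦ ?_
        rw [hWmass]
        ring
    _ = ∫⁻ X, ∑' i : ℕ × ℕ, (W i).indicator (fun _ ↦ (i.2 : ℝ≥0∞) ^ 2) X ∂(annealed Q 0) := by
        rw [lintegral_tsum fun i ↦ (measurable_const.indicator (hWm i)).aemeasurable]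
        exact tsum_congr fun i ↦ (lintegral_indicator_const (hWm i) _).symm
    _ ≤ regGapMoment Q 2 := lintegral_mono hpoint

/-- The renewal inequality: a visited site is visited in the first cycle or after it. -/
lemma visitWeight_le (x : Lattice d) :
    visitWeight Q x ≤ annealed Q 0 (noBacktrack d) * cycleOccupation Q x +
      ∫⁻ v, visitWeight Q (x - v) ∂(renewalLaw Q) := by
  have hdet : ∀ n, DeterminedBy n (cycleEvent d n ∩ {X | ∃ i < n, X i = x}) := fun n ↦
    (determinedBy_cycleEvent n).inter fun X Y h ⟨i, hi, hX⟩ ↦ ⟨i, hi, (h i hi.le).symm.trans hX⟩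
  have hrec : ∀ n, cycleEvent d n ∩ {X | ∃ i < n, X i = x} ⊆ recordAt d n := fun n X hX ↦
    hX.1.1.2
  have hsecond : ∀ n, annealed Q 0 (cycleEvent d n ∩
      tail n ⁻¹' ({X | ∃ i, X i = x} ∩ noBacktrack d)) =
      ∑' y, visitWeight Q (x - y) * annealed Q 0 (cycleEvent d n ∩ {X | X n = y}) := by
    intro n
    have hm : MeasurableSet (tail n ⁻¹' ({X : Path d | ∃ i, X i = x} ∩ noBacktrack d)) :=
      measurable_tail n ((measurableSet_visit x).inter measurableSet_noBacktrack)
    rw [measure_eq_tsum_eval _ n ((determinedBy_cycleEvent n).measurableSet.inter hm)]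
    refine tsum_congr fun y ↦ ?_
    rw [Set.inter_right_comm, annealed_inter_tail Q 0 y (determinedBy_cycleEvent n)
      (cycleEvent_subset_recordAt n) (measurableSet_visit x), annealed_visit, mul_comm]
  calc visitWeight Q x
      ≤ annealed Q 0 (⋃ n, ((cycleEvent d n ∩ {X | ∃ i < n, X i = x}) ∩
          tail n ⁻¹' noBacktrack d) ∪
          (cycleEvent d n ∩ tail n ⁻¹' ({X | ∃ i, X i = x} ∩ noBacktrack d))) := by
        refine measure_mono_ae ?_
        filter_upwards [ae_infinitely_many_regenerations Q htr] with X hX hXm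
        obtain ⟨⟨i, hi⟩, hD⟩ := hXm
        obtain ⟨n, hn⟩ := exists_mem_cycleEvent hD (hX 1)
        refine Set.mem_iUnion.2 ⟨n, ?_⟩
        by_cases hin : i < n
        · exact Or.inl ⟨⟨hn.1, i, hin, hi⟩, hn.2⟩
        · refine Or.inr ⟨hn.1, ⟨i - n, ?_⟩, hn.2⟩
          simpa [tail, show n + (i - n) = i by lia] using hi
    _ ≤ ∑' n, (annealed Q 0 (cycleEvent d n ∩ {X | ∃ i < n, X i = x}) *
          annealed Q 0 (noBacktrack d) +
          ∑' y, visitWeight Q (x - y) * annealed Q 0 (cycleEvent d n ∩ {X | X n = y})) := by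
        refine (measure_iUnion_le _).trans (ENNReal.tsum_le_tsum fun n ↦ ?_)
        refine (measure_union_le _ _).trans (le_of_eq ?_)
        rw [annealed_inter_tail_noBacktrack Q 0 (hdet n) (hrec n), hsecond]
    _ = _ := by
        rw [ENNReal.tsum_add, ENNReal.tsum_mul_right, lintegral_renewalLaw, cycleOccupation,
          mul_comm]

end transient

lemma renewalLaw_apply (S : Set (Lattice d)) :
    renewalLaw Q S = ∑' n, annealed Q 0 (cycleEvent d n ∩ {X | X n ∈ S}) := by
  rw [renewalLaw, Measure.sum_apply _ S.to_countable.measurableSet]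
  refine tsum_congr fun n ↦ ?_
  rw [Measure.map_apply (measurable_pi_apply n) S.to_countable.measurableSet,
    Measure.restrict_apply (measurable_pi_apply n S.to_countable.measurableSet), Set.inter_comm]
  rfl

lemma ae_one_le_renewalLaw : ∀ᵐ v ∂(renewalLaw Q), 1 ≤ v 0 := by
  rw [ae_iff, renewalLaw_apply, ENNReal.tsum_eq_zero]
  intro n
  refine measure_mono_null ?_ (ae_iff.1 (ae_start Q 0))
  intro X hX h0
  have h1 := hX.1.1.2 0 hX.1.2.1
  rw [h0] at h1
  exact hX.2 h1

omit [NeZero d] in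
lemma annealed_eval_eq_zero {i : ℕ} {y : Lattice d} (h : (i : ℝ) < ‖y‖) :
    annealed Q 0 {X | X i = y} = 0 := by
  refine measure_mono_null ?_ (ae_iff.1 (ae_norm_le Q 0))
  intro X hX hle
  have := hle i
  rw [(hX : X i = y), sub_zero] at this
  exact absurd this (not_le.2 h)

omit [NeZero d] in
lemma enorm_le_natCast {y : Lattice d} {n : ℕ} (h : ‖y‖ ≤ n) : ‖y‖ₑ ≤ n := by
  rw [← ofReal_norm, ← ENNReal.ofReal_natCast]
  exact ENNReal.ofReal_le_ofReal h

lemma lintegral_enorm_sq_renewalLaw_le :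
    ∫⁻ v, ‖v‖ₑ ^ 2 ∂(renewalLaw Q) ≤ cycleSecondMoment Q := by
  rw [lintegral_renewalLaw]
  refine ENNReal.tsum_le_tsum fun n ↦ ?_
  rw [measure_eq_tsum_eval _ n (determinedBy_cycleEvent n).measurableSet, ← ENNReal.tsum_mul_left]
  refine ENNReal.tsum_le_tsum fun y ↦ ?_
  by_cases hy : ‖y‖ ≤ n
  · gcongr
    exact enorm_le_natCast hy
  · rw [measure_mono_null Set.inter_subset_right (annealed_eval_eq_zero Q (not_le.1 hy))]
    simp

/-- A cycle of duration `n` visits at most `n` sites, all of norm less than `n`. -/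
lemma tsum_cycleOccupation_le :
    ∑' x, cycleOccupation Q x * (1 + ‖x‖ₑ) ≤ cycleSecondMoment Q := by
  have hterm : ∀ (n i : ℕ) (x : Lattice d), i < n →
      annealed Q 0 (cycleEvent d n ∩ {X | X i = x}) * (1 + ‖x‖ₑ) ≤
      annealed Q 0 (cycleEvent d n ∩ {X | X i = x}) * n := by
    intro n i x hi
    by_cases hx : ‖x‖ ≤ i
    · gcongr
      calc (1 : ℝ≥0∞) + ‖x‖ₑ ≤ 1 + (i : ℕ) := by gcongr; exact enorm_le_natCast hx
        _ = ((1 + i : ℕ) : ℝ≥0∞) := by push_cast; rfl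
        _ ≤ n := by exact_mod_cast (by lia : 1 + i ≤ n)
    · rw [measure_mono_null Set.inter_subset_right (annealed_eval_eq_zero Q (not_le.1 hx))]
      simp
  calc ∑' x, cycleOccupation Q x * (1 + ‖x‖ₑ)
      ≤ ∑' x, ∑' n, ∑ i ∈ Finset.range n,
          annealed Q 0 (cycleEvent d n ∩ {X | X i = x}) * n := by
        refine ENNReal.tsum_le_tsum fun x ↦ ?_
        rw [cycleOccupation, ← ENNReal.tsum_mul_right]
        refine ENNReal.tsum_le_tsum fun n ↦ ?_
        calc annealed Q 0 (cycleEvent d n ∩ {X | ∃ i < n, X i = x}) * (1 + ‖x‖ₑ)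
            ≤ (∑ i ∈ Finset.range n, annealed Q 0 (cycleEvent d n ∩ {X | X i = x})) *
              (1 + ‖x‖ₑ) := by
              gcongr
              refine le_trans (measure_mono ?_) (measure_biUnion_finset_le _ _)
              rintro X ⟨hX, i, hi, hXi⟩
              exact Set.mem_biUnion (Finset.mem_coe.2 (Finset.mem_range.2 hi)) ⟨hX, hXi⟩
          _ ≤ _ := by
              rw [Finset.sum_mul]
              exact Finset.sum_le_sum fun i hi ↦ hterm n i x (Finset.mem_range.1 hi)
    _ = ∑' n, ∑ i ∈ Finset.range n, ∑' x,
          annealed Q 0 (cycleEvent d n ∩ {X | X i = x}) * n := by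
        rw [ENNReal.tsum_comm]
        exact tsum_congr fun n ↦ Summable.tsum_finsetSum fun i _ ↦ ENNReal.summable
    _ = cycleSecondMoment Q := by
        refine tsum_congr fun n ↦ ?_
        simp_rw [ENNReal.tsum_mul_right,
          ← measure_eq_tsum_eval (annealed Q 0) _ (determinedBy_cycleEvent n).measurableSet]
        rw [Finset.sum_const, Finset.card_range, nsmul_eq_mul]
        ring

/-! ### Atoms of the renewal law -/

lemma pow_le_renewalLaw {κ : ℝ} (hQ : UniformlyElliptic κ Q) {γ : Path d} {n : ℕ} (h0 : γ 0 = 0)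
    (hγ : ∀ i < n, ∃ e : Dir d, γ (i + 1) = γ i + e.vec) (hc : γ ∈ cycleEvent d n) :
    ENNReal.ofReal κ ^ n ≤ renewalLaw Q {γ n} := by
  have h1 := pow_le_annealed_cyl Q hQ γ n hγ
  rw [h0] at h1
  rw [renewalLaw_apply]
  refine h1.trans (le_trans (measure_mono fun X hX ↦ ?_) (ENNReal.le_tsum n))
  exact ⟨determinedBy_cycleEvent n γ X (fun i hi ↦ (hX i hi).symm) hc, hX n le_rfl⟩

/-- In every coordinate direction, the renewal law has two neighbouring atoms of a size that is
controlled by the ellipticity constant. -/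
lemma exists_atoms_renewalLaw {κ : ℝ} (hκ1 : κ ≤ 1) (hQ : UniformlyElliptic κ Q)
    (j : Fin d) : ∃ a : Lattice d, ENNReal.ofReal κ ^ 4 ≤ renewalLaw Q {a} ∧
      ENNReal.ofReal κ ^ 4 ≤ renewalLaw Q {a + Pi.single j 1} := by
  have hpow : ∀ n ≤ 4, ENNReal.ofReal κ ^ 4 ≤ ENNReal.ofReal κ ^ n := fun n hn ↦
    pow_le_pow_of_le_one zero_le (by simpa using hκ1) hn
  let u : Lattice d := Pi.single 0 1
  have hu : u 0 = 1 := Pi.single_eq_same _ _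
  have hvec : ∀ i : Fin d, Dir.vec ((i, true) : Dir d) = Pi.single i 1 := fun i ↦ by simp [Dir.vec]
  have hvec' : Dir.vec (((0 : Fin d), false) : Dir d) = -u := by
    simp only [Dir.vec, u, Bool.false_eq_true, if_false, Pi.single_neg]
  refine ⟨u, ?_, ?_⟩
  · let γ : Path d := fun n ↦ if n = 0 then 0 else u
    refine (hpow 1 (by lia)).trans (pow_le_renewalLaw Q hQ (γ := γ) (n := 1) rfl ?_ ?_)
    · intro i hi
      obtain rfl : i = 0 := by lia
      exact ⟨(0, true), by simp [γ, hvec, u]⟩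
    · refine ⟨⟨fun i hi ↦ ?_, fun i hi ↦ ?_⟩, by lia, fun t h1 h2 ↦ by lia⟩
      · interval_cases i <;> simp [γ, hu]
      · interval_cases i; simp [γ, hu]
  · by_cases hj : j = 0
    · subst hj
      -- On the path `0, e₁, 0, e₁, 2e₁` the return to `0` spoils the regeneration at the first
      -- visit of `e₁`, and the second visit is no record; so the first regeneration is at `2e₁`.
      let γ : Path d := fun n ↦ if n = 0 then 0 else if n = 1 then u else if n = 2 then 0 else
        if n = 3 then u else u + u
      refine pow_le_renewalLaw Q hQ (γ := γ) (n := 4) rfl ?_ ?_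
      · intro i hi
        interval_cases i
        · exact ⟨(0, true), by simp [γ, hvec, u]⟩
        · exact ⟨(0, false), by simp [γ, hvec']⟩
        · exact ⟨(0, true), by simp [γ, hvec, u]⟩
        · exact ⟨(0, true), by simp [γ, hvec, u]⟩
      · refine ⟨⟨fun i hi ↦ ?_, fun i hi ↦ ?_⟩, by lia, fun t h1 h2 hr ↦ ?_⟩
        · interval_cases i <;> simp [γ, hu]
        · interval_cases i <;> simp [γ, hu]
        · interval_cases t
          · have := hr.2 2 (by lia) (by lia)
            simp [γ, hu] at this
          · have := hr.1 0 (by lia)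
            simp [γ] at this
          · have := hr.1 1 (by lia)
            simp [γ] at this
    · let w : Lattice d := Pi.single j 1
      have hw : w 0 = 0 := Pi.single_eq_of_ne (Ne.symm hj) _
      let γ : Path d := fun n ↦ if n = 0 then 0 else if n = 1 then w else u + w
      refine (hpow 2 (by lia)).trans (pow_le_renewalLaw Q hQ (γ := γ) (n := 2) rfl ?_ ?_)
      · intro i hi
        interval_cases i
        · exact ⟨(j, true), by simp [γ, hvec, w]⟩
        · exact ⟨(0, true), by simp [γ, hvec, u, add_comm]⟩
      · refine ⟨⟨fun i hi ↦ ?_, fun i hi ↦ ?_⟩, by lia, fun t h1 h2 hr ↦ ?_⟩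
        · interval_cases i <;> simp [γ, hu, hw]
        · interval_cases i <;> simp [γ, hu, hw]
        · obtain rfl : t = 1 := by lia
          have := hr.1 0 (by lia)
          simp [γ, hw] at this

end RWRE

namespace RWRE

/-! ### The local limit bound -/

variable {d : ℕ}

/-- The law of the `k`-th position of the random walk from the origin with step law `ν`. -/
noncomputable def convPow (ν : Measure (Lattice d)) : ℕ → Lattice d → ℝ≥0∞
  | 0 => fun z ↦ if z = 0 then 1 else 0
  | k + 1 => fun z ↦ ∫⁻ v, convPow ν k (z - v) ∂ν

lemma convPow_le_one (ν : Measure (Lattice d)) [IsProbabilityMeasure ν] (k : ℕ) (z : Lattice d) :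
    convPow ν k z ≤ 1 := by
  induction k generalizing z with
  | zero => simp only [convPow]; split_ifs <;> simp
  | succ k ih =>
    rw [convPow]
    calc _ ≤ ∫⁻ _, 1 ∂ν := lintegral_mono fun v ↦ ih _
      _ = 1 := by simp

/-- The character `v ↦ exp (i θ ⬝ v)` of the lattice. -/
noncomputable def latticeChar (θ : Fin d → ℝ) (v : Lattice d) : ℂ :=
  Complex.exp ((∑ j, θ j * (v j : ℝ) : ℝ) * Complex.I)

lemma latticeChar_add (θ : Fin d → ℝ) (v w : Lattice d) :
    latticeChar θ (v + w) = latticeChar θ v * latticeChar θ w := by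
  rw [latticeChar, latticeChar, latticeChar, ← Complex.exp_add, ← add_mul, ← Complex.ofReal_add,
    ← Finset.sum_add_distrib]
  simp [mul_add]

lemma norm_latticeChar (θ : Fin d → ℝ) (v : Lattice d) : ‖latticeChar θ v‖ = 1 :=
  Complex.norm_exp_ofReal_mul_I _

lemma measurable_latticeChar {α : Type*} [MeasurableSpace α] {f : α → Fin d → ℝ}
    {g : α → Lattice d} (hf : Measurable f) (hg : Measurable g) :
    Measurable fun a ↦ latticeChar (f a) (g a) := by
  unfold RWRE.latticeChar
  have : ∀ j, Measurable fun a ↦ ((g a j : ℤ) : ℝ) := fun j ↦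
    (measurable_of_countable fun n : ℤ ↦ (n : ℝ)).comp ((measurable_pi_apply j).comp hg)
  fun_prop

/-- The characteristic function of `ν`. -/
noncomputable def latticeCharFun (ν : Measure (Lattice d)) (θ : Fin d → ℝ) : ℂ :=
  ∫ v, latticeChar θ v ∂ν

lemma measurable_latticeCharFun (ν : Measure (Lattice d)) [IsProbabilityMeasure ν] :
    Measurable (latticeCharFun ν) :=
  ((measurable_latticeChar measurable_fst
    measurable_snd).stronglyMeasurable.integral_prod_right').measurable

lemma norm_latticeCharFun_le_one (ν : Measure (Lattice d)) [IsProbabilityMeasure ν]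
    (θ : Fin d → ℝ) : ‖latticeCharFun ν θ‖ ≤ 1 := by
  refine (norm_integral_le_integral_norm _).trans ?_
  simp [norm_latticeChar]

/-- Lebesgue measure on the box `(-π, π]^d`. -/
noncomputable def boxMeasure (d : ℕ) : Measure (Fin d → ℝ) :=
  Measure.pi fun _ ↦ volume.restrict (Set.Ioc (-Real.pi) Real.pi)

instance : IsFiniteMeasure (boxMeasure d) := by unfold boxMeasure; infer_instance

lemma integral_exp_int_mul (n : ℤ) :
    ∫ x in Set.Ioc (-Real.pi) Real.pi, Complex.exp ((x * (n : ℝ) : ℝ) * Complex.I) =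
      if n = 0 then (2 * Real.pi : ℂ) else 0 := by
  rw [← intervalIntegral.integral_of_le (by linarith [Real.pi_pos])]
  split_ifs with h
  · subst h
    simp
    ring
  · have hc : ((n : ℂ) * Complex.I) ≠ 0 :=
      mul_ne_zero (by exact_mod_cast h) Complex.I_ne_zero
    have h1 : ∀ x : ℝ, Complex.exp ((x * (n : ℝ) : ℝ) * Complex.I) =
        Complex.exp ((n : ℂ) * Complex.I * x) := fun x ↦ by
      congr 1; push_cast; ring
    simp_rw [h1]
    rw [integral_exp_mul_complex hc]
    have h2 : Complex.exp ((n : ℂ) * Complex.I * (Real.pi : ℝ)) =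
        Complex.exp ((n : ℂ) * Complex.I * ((-Real.pi : ℝ) : ℂ)) := by
      rw [Complex.exp_eq_exp_iff_exists_int]
      exact ⟨n, by push_cast; ring⟩
    rw [h2, sub_self, zero_div]

lemma integrable_latticeCharFun_pow (ν : Measure (Lattice d)) [IsProbabilityMeasure ν] (k : ℕ)
    (z : Lattice d) : Integrable (fun p : (Fin d → ℝ) × Lattice d ↦
      latticeCharFun ν p.1 ^ k * latticeChar p.1 (-(z - p.2))) ((boxMeasure d).prod ν) := by
  have m1 : Measurable fun p : (Fin d → ℝ) × Lattice d ↦ latticeCharFun ν p.1 ^ k :=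
    ((measurable_latticeCharFun ν).comp measurable_fst).pow_const k
  have m2 : Measurable fun p : (Fin d → ℝ) × Lattice d ↦ -(z - p.2) :=
    (measurable_of_countable fun v : Lattice d ↦ -(z - v)).comp measurable_snd
  have m3 : Measurable fun p : (Fin d → ℝ) × Lattice d ↦ latticeChar p.1 (-(z - p.2)) :=
    measurable_latticeChar measurable_fst m2
  have m4 : Measurable fun p : (Fin d → ℝ) × Lattice d ↦
      latticeCharFun ν p.1 ^ k * latticeChar p.1 (-(z - p.2)) := m1.mul m3
  refine Integrable.of_bound m4.aestronglyMeasurable 1 (ae_of_all _ fun p ↦ ?_)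
  rw [norm_mul, norm_pow, norm_latticeChar, mul_one]
  exact pow_le_one₀ (norm_nonneg _) (norm_latticeCharFun_le_one ν _)

/-- Fourier inversion for the convolution powers of `ν`. -/
lemma integral_latticeCharFun_pow (ν : Measure (Lattice d)) [IsProbabilityMeasure ν] (k : ℕ)
    (z : Lattice d) :
    ∫ θ, latticeCharFun ν θ ^ k * latticeChar θ (-z) ∂(boxMeasure d) =
      (2 * Real.pi : ℂ) ^ d * ((convPow ν k z).toReal : ℂ) := by
  induction k generalizing z with
  | zero =>
    have h1 : ∀ θ : Fin d → ℝ, latticeCharFun ν θ ^ 0 * latticeChar θ (-z) =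
        ∏ j, Complex.exp ((θ j * ((-z j : ℤ) : ℝ) : ℝ) * Complex.I) := fun θ ↦ by
      rw [pow_zero, one_mul, latticeChar, ← Complex.exp_sum, ← Finset.sum_mul]
      simp
    simp_rw [h1]
    rw [boxMeasure, integral_fintype_prod_eq_prod (𝕜 := ℂ)
      (f := fun j x ↦ Complex.exp ((x * ((-z j : ℤ) : ℝ) : ℝ) * Complex.I))]
    simp_rw [integral_exp_int_mul, neg_eq_zero]
    by_cases hz : z = 0
    · subst hz
      simp [convPow]
    · obtain ⟨j, hj⟩ := Function.ne_iff.1 hz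
      rw [Finset.prod_eq_zero (Finset.mem_univ j) (if_neg hj)]
      simp [convPow, hz]
  | succ k ih =>
    have hint := integrable_latticeCharFun_pow ν k z
    have h1 : ∀ θ : Fin d → ℝ, latticeCharFun ν θ ^ (k + 1) * latticeChar θ (-z) =
        ∫ v, latticeCharFun ν θ ^ k * latticeChar θ (-(z - v)) ∂ν := fun θ ↦ by
      have : ∀ v, latticeCharFun ν θ ^ k * latticeChar θ (-(z - v)) =
          latticeCharFun ν θ ^ k * latticeChar θ (-z) * latticeChar θ v := fun v ↦ by
        rw [show -(z - v) = -z + v by abel, latticeChar_add]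
        ring
      simp_rw [this]
      rw [integral_const_mul, ← latticeCharFun]
      ring
    simp_rw [h1]
    rw [integral_integral_swap hint]
    simp_rw [ih]
    rw [integral_const_mul, integral_complex_ofReal]
    congr 2
    rw [convPow, integral_toReal (measurable_of_countable _).aemeasurable
      (ae_of_all _ fun v ↦ (convPow_le_one ν k _).trans_lt ENNReal.one_lt_top)]

lemma norm_one_add_exp_le {t : ℝ} (ht : |t| ≤ Real.pi) :
    ‖1 + Complex.exp (t * Complex.I)‖ ≤ 2 - t ^ 2 / Real.pi ^ 2 := by
  have hpi := Real.pi_pos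
  have ht2 : t ^ 2 / Real.pi ^ 2 ≤ 1 := by
    rw [div_le_one (by positivity)]
    exact sq_le_sq' (by linarith [abs_le.1 ht]) (abs_le.1 ht).2
  refine abs_le_of_sq_le_sq' ?_ (by linarith) |>.2
  have h1 : ‖1 + Complex.exp (t * Complex.I)‖ ^ 2 = 2 + 2 * Real.cos t := by
    rw [← Complex.normSq_eq_norm_sq, Complex.normSq_apply]
    simp only [Complex.add_re, Complex.add_im, Complex.one_re, Complex.one_im,
      Complex.exp_ofReal_mul_I_re, Complex.exp_ofReal_mul_I_im]
    nlinarith [Real.sin_sq_add_cos_sq t]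
  have h3 : Real.cos t ≤ 1 - 2 * (t ^ 2 / Real.pi ^ 2) := by
    have := Real.cos_le_one_sub_mul_cos_sq ht
    calc Real.cos t ≤ 1 - 2 / Real.pi ^ 2 * t ^ 2 := this
      _ = _ := by ring
  rw [h1]
  nlinarith [sq_nonneg (t ^ 2 / Real.pi ^ 2)]

/-- Two neighbouring atoms of `ν` make its characteristic function decay in the direction of their
difference. -/
lemma norm_latticeCharFun_le_exp (ν : Measure (Lattice d)) [IsProbabilityMeasure ν] {δ : ℝ}
    (hδ : 0 ≤ δ) {j : Fin d} {a : Lattice d} (ha : δ ≤ ν.real {a})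
    (hb : δ ≤ ν.real {a + Pi.single j 1}) {θ : Fin d → ℝ} (hθ : |θ j| ≤ Real.pi) :
    ‖latticeCharFun ν θ‖ ≤ Real.exp (-(δ / Real.pi ^ 2) * θ j ^ 2) := by
  set b : Lattice d := a + Pi.single j 1 with hbdef
  have hab : a ≠ b := by
    intro h
    have := congrFun h j
    simp [hbdef] at this
  have hint : Integrable (latticeChar θ) ν :=
    Integrable.of_bound (measurable_of_countable _).aestronglyMeasurable 1
      (ae_of_all _ fun v ↦ (norm_latticeChar θ v).le)
  have hA : MeasurableSet ({a, b} : Set (Lattice d)) := (Set.to_countable _).measurableSet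
  have hsplit : latticeCharFun ν θ = (∫ v in {a, b}, latticeChar θ v ∂ν) +
      ∫ v in {a, b}ᶜ, latticeChar θ v ∂ν := (integral_add_compl hA hint).symm
  have hpair : ∫ v in {a, b}, latticeChar θ v ∂ν =
      ν.real {a} * latticeChar θ a + ν.real {b} * latticeChar θ b := by
    rw [Set.insert_eq, setIntegral_union (by simpa using hab) (measurableSet_singleton b)
      hint.integrableOn hint.integrableOn, integral_singleton, integral_singleton]
    simp
  have hchar : latticeChar θ b = latticeChar θ a * Complex.exp (θ j * Complex.I) := by
    rw [hbdef, latticeChar_add]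
    congr 1
    rw [latticeChar]
    congr 2
    rw [Finset.sum_eq_single j]
    · simp
    · intro i _ hi
      simp [Pi.single_eq_of_ne hi]
    · simp
  have hcompl : ‖∫ v in {a, b}ᶜ, latticeChar θ v ∂ν‖ ≤ 1 - ν.real {a} - ν.real {b} := by
    refine (norm_integral_le_integral_norm _).trans (le_of_eq ?_)
    simp only [norm_latticeChar, integral_const, smul_eq_mul, mul_one]
    rw [measureReal_restrict_apply_univ, probReal_compl_eq_one_sub hA, Set.insert_eq,
      measureReal_union (by simpa using hab) (measurableSet_singleton b)]
    ring
  have hpair' : ‖ν.real {a} * latticeChar θ a + ν.real {b} * latticeChar θ b‖ ≤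
      (ν.real {a} - δ) + (ν.real {b} - δ) + δ * (2 - θ j ^ 2 / Real.pi ^ 2) := by
    have : ν.real {a} * latticeChar θ a + ν.real {b} * latticeChar θ b =
        ((ν.real {a} - δ : ℝ) : ℂ) * latticeChar θ a +
        ((ν.real {b} - δ : ℝ) : ℂ) * latticeChar θ b +
        (δ : ℂ) * latticeChar θ a * (1 + Complex.exp (θ j * Complex.I)) := by
      rw [hchar]; push_cast; ring
    rw [this]
    refine (norm_add₃_le).trans (add_le_add (add_le_add ?_ ?_) ?_)
    · rw [norm_mul, norm_latticeChar, mul_one, Complex.norm_of_nonneg (by linarith)]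
    · rw [norm_mul, norm_latticeChar, mul_one, Complex.norm_of_nonneg (by linarith)]
    · rw [norm_mul, norm_mul, norm_latticeChar, mul_one, Complex.norm_of_nonneg hδ]
      exact mul_le_mul_of_nonneg_left (norm_one_add_exp_le hθ) hδ
  calc ‖latticeCharFun ν θ‖ ≤ 1 + (-(δ / Real.pi ^ 2) * θ j ^ 2) := by
        rw [hsplit, hpair]
        refine (norm_add_le _ _).trans ((add_le_add hpair' hcompl).trans (le_of_eq ?_))
        ring
    _ ≤ _ := by
        rw [add_comm]
        exact Real.add_one_le_exp _

lemma ae_boxMeasure : ∀ᵐ θ ∂(boxMeasure d), ∀ j, |θ j| ≤ Real.pi := by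
  rw [ae_all_iff]
  intro j
  have h1 : ∀ᵐ x ∂(volume.restrict (Set.Ioc (-Real.pi) Real.pi)), |x| ≤ Real.pi := by
    filter_upwards [ae_restrict_mem measurableSet_Ioc] with x hx
    exact abs_le.2 ⟨hx.1.le, hx.2⟩
  exact (Measure.quasiMeasurePreserving_eval
    (μ := fun _ : Fin d ↦ volume.restrict (Set.Ioc (-Real.pi) Real.pi)) j).ae h1

/-- The local limit bound: if `ν` has neighbouring atoms in all coordinate directions, the
probabilities of its `k`-th convolution power are of order `k ^ (-d/2)`. -/
lemma convPow_le_of_atoms [NeZero d] (ν : Measure (Lattice d)) [IsProbabilityMeasure ν] {δ : ℝ}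
    (hδ : 0 < δ)
    (hatoms : ∀ j, ∃ a : Lattice d, δ ≤ ν.real {a} ∧ δ ≤ ν.real {a + Pi.single j 1})
    {k : ℕ} (hk : 0 < k) (z : Lattice d) :
    (convPow ν k z).toReal ≤
      √(Real.pi / (δ / Real.pi ^ 2 / d * k)) ^ d := by
  have hd : (0 : ℝ) < d := by exact_mod_cast Nat.pos_of_ne_zero (NeZero.ne d)
  have hpi := Real.pi_pos
  set c : ℝ := δ / Real.pi ^ 2 / d with hc
  have hc0 : 0 < c := by positivity
  have hck : 0 < c * k := by positivity
  have hφ : ∀ᵐ θ ∂(boxMeasure d), ‖latticeCharFun ν θ ^ k * latticeChar θ (-z)‖ ≤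
      ∏ j, Real.exp (-(c * k) * θ j ^ 2) := by
    filter_upwards [ae_boxMeasure] with θ hθ
    obtain ⟨j, -, hj⟩ := Finset.exists_max_image Finset.univ (fun j : Fin d ↦ θ j ^ 2)
      ⟨0, Finset.mem_univ _⟩
    obtain ⟨a, ha, hb⟩ := hatoms j
    have h1 := norm_latticeCharFun_le_exp ν hδ.le ha hb (hθ j)
    have h2 : ∑ i, θ i ^ 2 ≤ d * θ j ^ 2 := by
      refine (Finset.sum_le_card_nsmul _ _ _ hj).trans (le_of_eq ?_)
      simp
    rw [norm_mul, norm_latticeChar, mul_one, norm_pow, ← Real.exp_sum, ← Finset.mul_sum]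
    calc ‖latticeCharFun ν θ‖ ^ k ≤ Real.exp (-(δ / Real.pi ^ 2) * θ j ^ 2) ^ k := by gcongr
      _ = Real.exp (k * (-(δ / Real.pi ^ 2) * θ j ^ 2)) := by rw [← Real.exp_nat_mul]
      _ ≤ _ := by
        refine Real.exp_le_exp.2 ?_
        have h3 : c * d = δ / Real.pi ^ 2 := by rw [hc]; field_simp
        have h4 := mul_le_mul_of_nonneg_left h2 hck.le
        rw [← h3]
        nlinarith
  have hgauss : Integrable fun x : ℝ ↦ Real.exp (-(c * k) * x ^ 2) := integrable_exp_neg_mul_sq hck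
  have hle : ∫ θ, ∏ j, Real.exp (-(c * k) * θ j ^ 2) ∂(boxMeasure d) ≤
      √(Real.pi / (c * k)) ^ d := by
    rw [boxMeasure, integral_fintype_prod_eq_prod (𝕜 := ℝ)
      (f := fun _ x ↦ Real.exp (-(c * k) * x ^ 2))]
    rw [Finset.prod_const, Finset.card_univ, Fintype.card_fin]
    refine pow_le_pow_left₀ (integral_nonneg fun x ↦ (Real.exp_pos _).le) ?_ d
    rw [← integral_gaussian]
    exact setIntegral_le_integral hgauss (ae_of_all _ fun x ↦ (Real.exp_pos _).le)
  have hfour := integral_latticeCharFun_pow ν k z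
  have h2pi : (1 : ℝ) ≤ (2 * Real.pi) ^ d := one_le_pow₀ (by linarith [Real.pi_gt_three])
  have hint : Integrable (fun θ : Fin d → ℝ ↦ ∏ j, Real.exp (-(c * k) * θ j ^ 2))
      (boxMeasure d) := by
    unfold boxMeasure
    exact Integrable.fintype_prod (f := fun _ x ↦ Real.exp (-(c * k) * x ^ 2))
      fun _ ↦ hgauss.restrict
  calc (convPow ν k z).toReal ≤ (2 * Real.pi) ^ d * (convPow ν k z).toReal :=
        le_mul_of_one_le_left ENNReal.toReal_nonneg h2pi
    _ = ‖(2 * Real.pi : ℂ) ^ d * ((convPow ν k z).toReal : ℂ)‖ := by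
        rw [norm_mul, norm_pow, Complex.norm_of_nonneg ENNReal.toReal_nonneg, norm_mul,
          Complex.norm_of_nonneg hpi.le]
        simp
    _ = ‖∫ θ, latticeCharFun ν θ ^ k * latticeChar θ (-z) ∂(boxMeasure d)‖ := by rw [hfour]
    _ ≤ ∫ θ, ∏ j, Real.exp (-(c * k) * θ j ^ 2) ∂(boxMeasure d) :=
        norm_integral_le_of_norm_le hint hφ
    _ ≤ _ := hle

end RWRE

namespace RWRE

/-! ### The Green function of the renewal walk -/

variable {d : ℕ}

/-- The expected number of visits to `z` at times `< n` of the random walk with step law `ν`. -/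
noncomputable def greenUpTo (ν : Measure (Lattice d)) (n : ℕ) (z : Lattice d) : ℝ≥0∞ :=
  ∑ k ∈ Finset.range n, convPow ν k z

/-- The Green function of the random walk with step law `ν`. -/
noncomputable def green (ν : Measure (Lattice d)) (z : Lattice d) : ℝ≥0∞ :=
  ∑' k, convPow ν k z

lemma greenUpTo_succ (ν : Measure (Lattice d)) (n : ℕ) (z : Lattice d) :
    greenUpTo ν (n + 1) z = (∫⁻ v, greenUpTo ν n (z - v) ∂ν) + if z = 0 then 1 else 0 := by
  rw [greenUpTo, Finset.sum_range_succ']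
  simp only [convPow, greenUpTo]
  rw [lintegral_finsetSum _ fun k _ ↦ measurable_of_countable _]

section level

variable [NeZero d] {ν : Measure (Lattice d)} (hlev : ∀ᵐ v ∂ν, 1 ≤ v 0)

include hlev

lemma convPow_eq_zero {k : ℕ} {z : Lattice d} (hz : z 0 < k) : convPow ν k z = 0 := by
  induction k generalizing z with
  | zero =>
    simp only [convPow]
    rw [if_neg]
    rintro rfl
    simp at hz
  | succ k ih =>
    simp only [convPow]
    rw [lintegral_eq_zero_iff (measurable_of_countable _)]
    filter_upwards [hlev] with v hv
    refine ih ?_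
    rw [Pi.sub_apply]
    push_cast at hz
    lia

lemma greenUpTo_eq_zero {n : ℕ} {z : Lattice d} (hz : z 0 < 0) : greenUpTo ν n z = 0 :=
  Finset.sum_eq_zero fun k _ ↦ convPow_eq_zero hlev (by lia)

/-- The walk with positive level increments visits each level at most once. -/
lemma tsum_level_greenUpTo_le [IsProbabilityMeasure ν] (n : ℕ) (l : ℤ) :
    ∑' z : Lattice d, (if z 0 = l then greenUpTo ν n z else 0) ≤ 1 := by
  induction n generalizing l with
  | zero => simp [greenUpTo]
  | succ n ih =>
    have hshift : ∀ v : Lattice d,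
        ∑' z : Lattice d, (if z 0 = l then greenUpTo ν n (z - v) else 0) =
        ∑' z : Lattice d, (if z 0 = l - v 0 then greenUpTo ν n z else 0) := by
      intro v
      rw [← (Equiv.addRight v).tsum_eq]
      refine tsum_congr fun z ↦ ?_
      simp only [Equiv.coe_addRight, Pi.add_apply, add_sub_cancel_right, eq_sub_iff_add_eq]
    have hsplit : ∑' z : Lattice d, (if z 0 = l then greenUpTo ν (n + 1) z else 0) =
        (∫⁻ v, ∑' z : Lattice d, (if z 0 = l - v 0 then greenUpTo ν n z else 0) ∂ν) +
          if l = 0 then 1 else 0 := by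
      have h1 : ∀ z : Lattice d, (if z 0 = l then greenUpTo ν (n + 1) z else 0) =
          (∫⁻ v, (if z 0 = l then greenUpTo ν n (z - v) else 0) ∂ν) +
            if z = 0 then (if l = 0 then 1 else 0) else 0 := by
        intro z
        by_cases hz : z 0 = l
        · simp only [hz, if_true, greenUpTo_succ]
          congr 1
          by_cases hz0 : z = 0
          · subst hz0
            simp [← hz]
          · simp [hz0]
        · simp only [hz, if_false, lintegral_zero, zero_add]
          by_cases hz0 : z = 0
          · subst hz0
            rw [if_pos rfl, if_neg fun h ↦ hz (by simp [h])]
          · simp [hz0]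
      simp_rw [h1, ← hshift]
      rw [ENNReal.tsum_add, lintegral_tsum fun z ↦ (measurable_of_countable _).aemeasurable]
      congr 1
      rw [tsum_eq_single 0 fun z hz ↦ if_neg hz, if_pos rfl]
    rw [hsplit]
    by_cases hl : l = 0
    · have h0 : ∫⁻ v, ∑' z : Lattice d, (if z 0 = l - v 0 then greenUpTo ν n z else 0) ∂ν = 0 := by
        rw [lintegral_eq_zero_iff (measurable_of_countable _)]
        filter_upwards [hlev] with v hv
        refine ENNReal.tsum_eq_zero.2 fun z ↦ ?_
        split_ifs with hz
        · exact greenUpTo_eq_zero hlev (by lia)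
        · rfl
      rw [h0, zero_add]
      rw [if_pos hl]
    · rw [if_neg hl, add_zero]
      calc _ ≤ ∫⁻ _, 1 ∂ν := lintegral_mono fun v ↦ ih _
        _ = 1 := by simp

lemma tsum_level_green_le [IsProbabilityMeasure ν] (l : ℤ) :
    ∑' z : Lattice d, (if z 0 = l then green ν z else 0) ≤ 1 := by
  have h1 : ∀ z : Lattice d, (if z 0 = l then green ν z else 0) =
      ∑' k, if z 0 = l then convPow ν k z else 0 := fun z ↦ by
    split_ifs <;> simp [green]
  simp_rw [h1]
  rw [ENNReal.tsum_comm]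
  refine ENNReal.tsum_le_of_sum_range_le fun n ↦ ?_
  rw [← Summable.tsum_finsetSum fun i _ ↦ ENNReal.summable]
  refine le_trans (le_of_eq (tsum_congr fun z ↦ ?_)) (tsum_level_greenUpTo_le hlev n l)
  split_ifs <;> simp [greenUpTo]

lemma greenUpTo_le_one [IsProbabilityMeasure ν] (n : ℕ) (z : Lattice d) :
    greenUpTo ν n z ≤ 1 := by
  refine le_trans ?_ (tsum_level_greenUpTo_le hlev n (z 0))
  refine le_trans (le_of_eq ?_) (ENNReal.le_tsum z)
  rw [if_pos rfl]

lemma green_le_one [IsProbabilityMeasure ν] (z : Lattice d) : green ν z ≤ 1 :=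
  ENNReal.tsum_le_of_sum_range_le fun n ↦ greenUpTo_le_one hlev n z

omit [NeZero d] hlev in
lemma integrable_norm_of_sq [IsProbabilityMeasure ν] (hint : Integrable (fun v ↦ ‖v‖ ^ 2) ν) :
    Integrable (fun v ↦ ‖v‖) ν := by
  refine ((integrable_const (1 : ℝ)).add hint).mono'
    (measurable_of_countable _).aestronglyMeasurable (ae_of_all _ fun v ↦ ?_)
  rw [norm_norm, Pi.add_apply]
  nlinarith [sq_nonneg (‖v‖ - 1), norm_nonneg v]

omit [NeZero d] hlev in
lemma lintegral_ofReal_quadratic_le [IsProbabilityMeasure ν]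
    (hint : Integrable (fun v ↦ ‖v‖ ^ 2) ν) {f : Lattice d → ℝ} {a b c e : ℝ}
    (hf : ∀ v, f v = a + b * ‖v‖ + c * ‖v‖ ^ 2) (hf0 : ∀ v, 0 ≤ f v)
    (he : a + b * (∫ v, ‖v‖ ∂ν) + c * (∫ v, ‖v‖ ^ 2 ∂ν) ≤ e) :
    ∫⁻ v, ENNReal.ofReal (f v) ∂ν ≤ ENNReal.ofReal e := by
  have h1 : Integrable (fun v ↦ a + b * ‖v‖) ν :=
    (integrable_const a).add ((integrable_norm_of_sq hint).const_mul b)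
  have h2 : Integrable (fun v ↦ a + b * ‖v‖ + c * ‖v‖ ^ 2) ν := h1.add (hint.const_mul c)
  have hfi : Integrable f ν := h2.congr (ae_of_all _ fun v ↦ (hf v).symm)
  rw [← ofReal_integral_eq_lintegral_ofReal hfi (ae_of_all _ hf0)]
  refine ENNReal.ofReal_le_ofReal ?_
  rw [integral_congr_ae (ae_of_all _ hf), integral_add h1 (hint.const_mul c),
    integral_add (integrable_const a) ((integrable_norm_of_sq hint).const_mul b),
    integral_const_mul, integral_const_mul]
  simpa using he

/-- A Chebyshev bound for the probability that the walk hits `z` within `n` steps. In its proof,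
`((t - i m)² + (n - i) s) / R²` bounds the probability of hitting a site at distance at least
`‖z‖ - t` within the remaining `n - i` steps; it is a supermartingale when `t` is the length
travelled in `i` steps. -/
lemma greenUpTo_le_of_lt [IsProbabilityMeasure ν] (hint : Integrable (fun v ↦ ‖v‖ ^ 2) ν)
    (n : ℕ) (z : Lattice d) (hn : n * ∫ v, ‖v‖ ∂ν < ‖z‖) :
    greenUpTo ν (n + 1) z ≤
      ENNReal.ofReal (n * (∫ v, ‖v‖ ^ 2 ∂ν) / (‖z‖ - n * ∫ v, ‖v‖ ∂ν) ^ 2) := by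
  obtain ⟨m, hm⟩ : ∃ m, m = ∫ v, ‖v‖ ∂ν := ⟨_, rfl⟩
  obtain ⟨s, hs⟩ : ∃ s, s = ∫ v, ‖v‖ ^ 2 ∂ν := ⟨_, rfl⟩
  have hm0 : 0 ≤ m := hm ▸ integral_nonneg fun v ↦ norm_nonneg v
  have hs0 : 0 ≤ s := hs ▸ integral_nonneg fun v ↦ sq_nonneg _
  rw [← hm] at hn
  rw [← hm, ← hs]
  obtain ⟨R, hR⟩ : ∃ R, R = ‖z‖ - n * m := ⟨_, rfl⟩
  rw [← hR]
  have hR0 : 0 < R := hR ▸ sub_pos.2 hn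
  have hzero : ∀ r i : ℕ, r + i = n → ∀ t : ℝ, ‖z‖ - t ≤ ‖(0 : Lattice d)‖ →
      greenUpTo ν (r + 1) 0 ≤ ENNReal.ofReal (((t - i * m) ^ 2 + r * s) / R ^ 2) := by
    intro r i hi t ht
    rw [norm_zero, sub_nonpos] at ht
    refine (greenUpTo_le_one hlev _ _).trans ?_
    rw [← ENNReal.ofReal_one]
    refine ENNReal.ofReal_le_ofReal ?_
    rw [one_le_div (by positivity)]
    have hin : (i : ℝ) * m ≤ n * m := by
      gcongr
      lia
    have h1 : R ≤ t - i * m := by rw [hR]; linarith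
    have h2 : R ^ 2 ≤ (t - i * m) ^ 2 := by gcongr
    have : 0 ≤ r * s := by positivity
    linarith
  have key : ∀ r i : ℕ, r + i = n → ∀ (t : ℝ) (w : Lattice d), ‖z‖ - t ≤ ‖w‖ →
      greenUpTo ν (r + 1) w ≤ ENNReal.ofReal (((t - i * m) ^ 2 + r * s) / R ^ 2) := by
    intro r
    induction r with
    | zero =>
      intro i hi t w hw
      by_cases hw0 : w = 0
      · subst hw0
        exact hzero 0 i hi t hw
      · simp [greenUpTo, convPow, hw0]
    | succ r ih =>
      intro i hi t w hw
      by_cases hw0 : w = 0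
      · subst hw0
        exact hzero (r + 1) i hi t hw
      · rw [greenUpTo_succ, if_neg hw0, add_zero]
        calc ∫⁻ v, greenUpTo ν (r + 1) (w - v) ∂ν
            ≤ ∫⁻ v, ENNReal.ofReal
                (((t + ‖v‖ - ((i + 1 : ℕ) : ℝ) * m) ^ 2 + r * s) / R ^ 2) ∂ν := by
              refine lintegral_mono fun v ↦ ih (i + 1) (by lia) (t + ‖v‖) (w - v) ?_
              have := norm_sub_norm_le w v
              linarith
          _ ≤ _ := by
              refine lintegral_ofReal_quadratic_le hint
                (a := ((t - i * m) ^ 2 - 2 * (t - i * m) * m + m ^ 2 + r * s) / R ^ 2)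
                (b := (2 * (t - i * m) - 2 * m) / R ^ 2) (c := 1 / R ^ 2)
                (fun v ↦ by push_cast; ring) (fun v ↦ by positivity) ?_
              rw [← hm, ← hs]
              have : ((t - i * m) ^ 2 + ((r + 1 : ℕ) : ℝ) * s) / R ^ 2 -
                  (((t - i * m) ^ 2 - 2 * (t - i * m) * m + m ^ 2 + r * s) / R ^ 2 +
                  (2 * (t - i * m) - 2 * m) / R ^ 2 * m + 1 / R ^ 2 * s) = m ^ 2 / R ^ 2 := by
                push_cast; ring
              have h2 : 0 ≤ m ^ 2 / R ^ 2 := by positivity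
              linarith
  have := key n 0 (by lia) 0 z (by simp)
  simpa using this

end level

end RWRE

namespace RWRE

/-! ### Decay of the Green function -/

variable {d : ℕ}

lemma rpow_neg_add_one_le_sub {s x : ℝ} (hs : 1 ≤ s) (hx : 0 < x) :
    (x + 1) ^ (-s - 1) ≤ x ^ (-s) - (x + 1) ^ (-s) := by
  have hx1 : 0 < x + 1 := by linarith
  have h1 : 1 + 1 / (x + 1) ≤ (1 + 1 / x) ^ s := by
    calc 1 + 1 / (x + 1) ≤ 1 + s * (1 / x) := by
          have : 1 / (x + 1) ≤ 1 / x := one_div_le_one_div_of_le hx (by linarith)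
          have h2 : 1 / x ≤ s * (1 / x) := le_mul_of_one_le_left (by positivity) hs
          linarith
      _ ≤ _ := one_add_mul_self_le_rpow_one_add (by
          have : 0 < 1 / x := by positivity
          linarith) hs
  have h2 : x ^ (-s) = (x + 1) ^ (-s) * (1 + 1 / x) ^ s := by
    rw [show 1 + 1 / x = (x + 1) / x by field_simp, Real.div_rpow hx1.le hx.le,
      Real.rpow_neg hx.le, Real.rpow_neg hx1.le]
    have := (Real.rpow_pos_of_pos hx1 s).ne'
    field_simp
  rw [h2, Real.rpow_sub hx1, Real.rpow_one]
  have := mul_le_mul_of_nonneg_left h1 (Real.rpow_pos_of_pos hx1 (-s)).le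
  calc (x + 1) ^ (-s) / (x + 1) = (x + 1) ^ (-s) * (1 + 1 / (x + 1)) - (x + 1) ^ (-s) := by ring
    _ ≤ _ := by linarith

/-- The tail of the series `∑ k ^ (-s - 1)`. -/
lemma tsum_ofReal_rpow_le {s : ℝ} (hs : 1 ≤ s) {n : ℕ} (hn : 0 < n) :
    ∑' k : ℕ, ENNReal.ofReal (((k + (n + 1) : ℕ) : ℝ) ^ (-s - 1)) ≤
      ENNReal.ofReal ((n : ℝ) ^ (-s)) := by
  refine ENNReal.tsum_le_of_sum_range_le fun N ↦ ?_
  rw [← ENNReal.ofReal_sum_of_nonneg fun k _ ↦ by positivity]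
  refine ENNReal.ofReal_le_ofReal ?_
  have hN : ∑ k ∈ Finset.range N, ((k + (n + 1) : ℕ) : ℝ) ^ (-s - 1) ≤
      (n : ℝ) ^ (-s) - ((N + n : ℕ) : ℝ) ^ (-s) := by
    induction N with
    | zero => simp
    | succ N ih =>
      rw [Finset.sum_range_succ]
      have := rpow_neg_add_one_le_sub hs (x := ((N + n : ℕ) : ℝ)) (by
        exact_mod_cast (by lia : 0 < N + n))
      have e1 : ((N + n : ℕ) : ℝ) + 1 = ((N + (n + 1) : ℕ) : ℝ) := by push_cast; ring
      have e2 : ((N + 1 + n : ℕ) : ℝ) = ((N + (n + 1) : ℕ) : ℝ) := by push_cast; ring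
      rw [e1] at this
      rw [e2]
      linarith
  have : 0 ≤ ((N + n : ℕ) : ℝ) ^ (-s) := by positivity
  linarith

lemma integral_norm_le_of_sq {ν : Measure (Lattice d)} [IsProbabilityMeasure ν]
    (hint : Integrable (fun v ↦ ‖v‖ ^ 2) ν) :
    ∫ v, ‖v‖ ∂ν ≤ (1 + ∫ v, ‖v‖ ^ 2 ∂ν) / 2 := by
  have hc : Integrable (fun _ : Lattice d ↦ (1 : ℝ)) ν := integrable_const 1
  have h2 : ∫ v, (1 + ‖v‖ ^ 2) ∂ν = 1 + ∫ v, ‖v‖ ^ 2 ∂ν := by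
    rw [integral_add hc hint]
    simp
  rw [← h2, ← integral_div]
  refine integral_mono (integrable_norm_of_sq hint) ((hc.add hint).div_const 2) fun v ↦ ?_
  change ‖v‖ ≤ (1 + ‖v‖ ^ 2) / 2
  linarith [sq_nonneg (‖v‖ - 1)]

lemma greenUpTo_le_of_two_mul_le [NeZero d] {ν : Measure (Lattice d)} [IsProbabilityMeasure ν]
    (hlev : ∀ᵐ v ∂ν, 1 ≤ v 0) (hint : Integrable (fun v ↦ ‖v‖ ^ 2) ν) {A : ℝ} (hA : 1 ≤ A)
    (hmom : ∫ v, ‖v‖ ^ 2 ∂ν ≤ A) {n : ℕ} {z : Lattice d} (hz : 0 < ‖z‖)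
    (hn : 2 * n * A ≤ ‖z‖) :
    greenUpTo ν (n + 1) z ≤ ENNReal.ofReal (4 * n * A / ‖z‖ ^ 2) := by
  have hmean : ∫ v, ‖v‖ ∂ν ≤ A := by linarith [integral_norm_le_of_sq hint]
  have hnm : n * ∫ v, ‖v‖ ∂ν ≤ ‖z‖ / 2 := by
    have : n * ∫ v, ‖v‖ ∂ν ≤ n * A := by gcongr
    linarith
  have hmom0 : 0 ≤ ∫ v, ‖v‖ ^ 2 ∂ν := integral_nonneg fun v ↦ sq_nonneg _
  refine (greenUpTo_le_of_lt hlev hint n z (by linarith)).trans (ENNReal.ofReal_le_ofReal ?_)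
  calc n * (∫ v, ‖v‖ ^ 2 ∂ν) / (‖z‖ - n * ∫ v, ‖v‖ ∂ν) ^ 2 ≤ n * A / (‖z‖ / 2) ^ 2 := by
        gcongr
        linarith
    _ = 4 * n * A / ‖z‖ ^ 2 := by field_simp; ring

lemma tsum_convPow_le (hd : 5 ≤ d) [NeZero d] (ν : Measure (Lattice d)) [IsProbabilityMeasure ν]
    {δ : ℝ} (hδ : 0 < δ)
    (hatoms : ∀ j, ∃ a : Lattice d, δ ≤ ν.real {a} ∧ δ ≤ ν.real {a + Pi.single j 1})
    {n : ℕ} (hn : 0 < n) (z : Lattice d) :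
    ∑' k, convPow ν (k + (n + 1)) z ≤
      ENNReal.ofReal ((Real.pi / (δ / Real.pi ^ 2 / d)) ^ ((d : ℝ) / 2) *
        (n : ℝ) ^ (-((d : ℝ) / 2 - 1))) := by
  have hd' : (5 : ℝ) ≤ d := by exact_mod_cast hd
  have hpi := Real.pi_pos
  obtain ⟨c, hc⟩ : ∃ c, c = δ / Real.pi ^ 2 / d := ⟨_, rfl⟩
  have hc0 : 0 < c := by rw [hc]; positivity
  obtain ⟨c₁, hc₁⟩ : ∃ c₁, c₁ = (Real.pi / c) ^ ((d : ℝ) / 2) := ⟨_, rfl⟩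
  have hc₁0 : 0 < c₁ := by rw [hc₁]; positivity
  rw [← hc, ← hc₁]
  calc ∑' k, convPow ν (k + (n + 1)) z
      ≤ ∑' k : ℕ, ENNReal.ofReal c₁ *
          ENNReal.ofReal (((k + (n + 1) : ℕ) : ℝ) ^ (-((d : ℝ) / 2 - 1) - 1)) := by
        refine ENNReal.tsum_le_tsum fun k ↦ ?_
        have h1 := convPow_le_of_atoms ν hδ hatoms (k := k + (n + 1)) (by lia) z
        rw [← ENNReal.ofReal_mul hc₁0.le, ← ENNReal.ofReal_toReal
          ((convPow_le_one ν (k + (n + 1)) z).trans_lt ENNReal.one_lt_top).ne]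
        refine ENNReal.ofReal_le_ofReal (h1.trans (le_of_eq ?_))
        have hpos : (0 : ℝ) < ((k + (n + 1) : ℕ) : ℝ) := by
          exact_mod_cast (by lia : 0 < k + (n + 1))
        rw [← hc, ← div_div, Real.sqrt_eq_rpow, ← Real.rpow_natCast,
          ← Real.rpow_mul (by positivity), Real.div_rpow (by positivity) hpos.le,
          show 1 / 2 * (d : ℝ) = (d : ℝ) / 2 by ring, ← hc₁,
          show -((d : ℝ) / 2 - 1) - 1 = -((d : ℝ) / 2) by ring, Real.rpow_neg hpos.le,
          div_eq_mul_inv]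
    _ ≤ ENNReal.ofReal c₁ * ENNReal.ofReal ((n : ℝ) ^ (-((d : ℝ) / 2 - 1))) := by
        rw [ENNReal.tsum_mul_left]
        gcongr
        exact tsum_ofReal_rpow_le (by linarith) hn
    _ = _ := (ENNReal.ofReal_mul hc₁0.le).symm

/-- The Green function of a renewal walk with a step law of bounded second moment and with atoms of
size at least `δ` decays like `‖z‖ ^ (-(2 - 4 / d))`: the first `‖z‖ ^ (4 / d)` steps are
controlled by their second moment, the later ones by the local limit bound. -/
lemma exists_green_le (hd : 5 ≤ d) [NeZero d] {δ A : ℝ} (hδ : 0 < δ) (hA : 1 ≤ A) :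
    ∃ C : ℝ, 0 < C ∧ ∀ (ν : Measure (Lattice d)) [IsProbabilityMeasure ν],
      (∀ᵐ v ∂ν, 1 ≤ v 0) → Integrable (fun v ↦ ‖v‖ ^ 2) ν → ∫ v, ‖v‖ ^ 2 ∂ν ≤ A →
      (∀ j, ∃ a : Lattice d, δ ≤ ν.real {a} ∧ δ ≤ ν.real {a + Pi.single j 1}) →
      ∀ z, green ν z ≤ ENNReal.ofReal (C * (1 + ‖z‖) ^ (-(2 - 4 / (d : ℝ)))) := by
  have hd' : (5 : ℝ) ≤ d := by exact_mod_cast hd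
  have hd0 : (0 : ℝ) < d := by linarith
  have h4d : 4 / (d : ℝ) < 1 := by rw [div_lt_one hd0]; linarith
  have h4d0 : 0 < 4 / (d : ℝ) := by positivity
  have hpi := Real.pi_pos
  obtain ⟨α, hα⟩ : ∃ α : ℝ, α = 2 - 4 / (d : ℝ) := ⟨_, rfl⟩
  obtain ⟨c₁, hc₁⟩ : ∃ c₁, c₁ = (Real.pi / (δ / Real.pi ^ 2 / d)) ^ ((d : ℝ) / 2) := ⟨_, rfl⟩
  have hc₁0 : 0 < c₁ := by rw [hc₁]; positivity
  obtain ⟨K₀, hK₀⟩ : ∃ K₀, K₀ = (4 * A) ^ (1 - 4 / (d : ℝ))⁻¹ := ⟨_, rfl⟩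
  have hK₀1 : 1 ≤ K₀ := by
    rw [hK₀]
    exact Real.one_le_rpow (by linarith) (inv_nonneg.2 (by linarith))
  rw [← hα]
  refine ⟨4 * (8 * A + c₁) + (1 + K₀) ^ α, by positivity, fun ν _ hlev hint hmom hatoms z ↦ ?_⟩
  obtain ⟨K, hK⟩ : ∃ K, K = ‖z‖ := ⟨_, rfl⟩
  rw [← hK]
  have hK0 : 0 ≤ K := hK ▸ norm_nonneg z
  have h1K : 0 < 1 + K := by linarith
  by_cases hKK : K < K₀
  · refine (green_le_one hlev z).trans ?_
    rw [← ENNReal.ofReal_one]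
    refine ENNReal.ofReal_le_ofReal ?_
    have hα0 : 0 < α := by linarith
    have h1 : (1 + K) ^ α ≤ (1 + K₀) ^ α := by gcongr
    have h2 : (1 + K) ^ α * (1 + K) ^ (-α) = 1 := by
      rw [← Real.rpow_add h1K, add_neg_cancel, Real.rpow_zero]
    calc 1 = (1 + K) ^ α * (1 + K) ^ (-α) := h2.symm
      _ ≤ (4 * (8 * A + c₁) + (1 + K₀) ^ α) * (1 + K) ^ (-α) := by
        gcongr
        have : 0 < 4 * (8 * A + c₁) := by positivity
        linarith
  · push Not at hKK
    have hK1 : 1 ≤ K := hK₀1.trans hKK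
    have hKpos : 0 < K := by linarith
    obtain ⟨y, hy⟩ : ∃ y, y = K ^ (4 / (d : ℝ)) := ⟨_, rfl⟩
    have hy1 : 1 ≤ y := hy ▸ Real.one_le_rpow hK1 h4d0.le
    obtain ⟨n, hn⟩ : ∃ n : ℕ, n = ⌈y⌉₊ := ⟨_, rfl⟩
    have hyn : y ≤ n := hn ▸ Nat.le_ceil y
    have hny : (n : ℝ) ≤ 2 * y := by
      have := Nat.ceil_lt_add_one (zero_le_one.trans hy1)
      rw [← hn] at this
      linarith
    have hn0 : 0 < n := hn ▸ Nat.ceil_pos.2 (by linarith)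
    have hyK : 4 * A * y ≤ K := by
      have h1 : 4 * A ≤ K ^ (1 - 4 / (d : ℝ)) := by
        calc 4 * A = K₀ ^ (1 - 4 / (d : ℝ)) := by
              rw [hK₀, Real.rpow_inv_rpow (by linarith) (by linarith)]
          _ ≤ _ := Real.rpow_le_rpow (by linarith) hKK (by linarith)
      calc 4 * A * y ≤ K ^ (1 - 4 / (d : ℝ)) * K ^ (4 / (d : ℝ)) := by rw [← hy]; gcongr
        _ = K := by rw [← Real.rpow_add hKpos]; simp
    have hyα : y / K ^ 2 = K ^ (-α) := by
      rw [hy, hα, ← Real.rpow_natCast K 2, ← Real.rpow_sub hKpos]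
      congr 1
      push_cast
      ring
    have hfirst : greenUpTo ν (n + 1) z ≤ ENNReal.ofReal (8 * A * K ^ (-α)) := by
      refine (greenUpTo_le_of_two_mul_le hlev hint hA hmom (n := n) (z := z) (hK ▸ hKpos) ?_).trans
        (ENNReal.ofReal_le_ofReal ?_)
      · rw [← hK]
        calc 2 * n * A ≤ 2 * (2 * y) * A := by gcongr
          _ = 4 * A * y := by ring
          _ ≤ K := hyK
      · rw [← hK]
        calc 4 * n * A / K ^ 2 ≤ 4 * (2 * y) * A / K ^ 2 := by gcongr
          _ = 8 * A * (y / K ^ 2) := by ring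
          _ = _ := by rw [hyα]
    have hsecond : ∑' k, convPow ν (k + (n + 1)) z ≤ ENNReal.ofReal (c₁ * K ^ (-α)) := by
      refine (tsum_convPow_le hd ν hδ hatoms hn0 z).trans (ENNReal.ofReal_le_ofReal ?_)
      rw [← hc₁]
      gcongr
      calc (n : ℝ) ^ (-((d : ℝ) / 2 - 1)) ≤ y ^ (-((d : ℝ) / 2 - 1)) :=
            Real.rpow_le_rpow_of_nonpos (by linarith) hyn (by linarith)
        _ = K ^ (-α) := by
            rw [hy, ← Real.rpow_mul hK0]
            congr 1
            rw [hα]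
            field_simp
            ring
    have hsum : green ν z = greenUpTo ν (n + 1) z + ∑' k, convPow ν (k + (n + 1)) z :=
      (ENNReal.summable.sum_add_tsum_nat_add' (f := fun k ↦ convPow ν k z)).symm
    have h2K : K ^ (-α) ≤ 4 * (1 + K) ^ (-α) := by
      have h1 : (2 * K) ^ (-α) ≤ (1 + K) ^ (-α) :=
        Real.rpow_le_rpow_of_nonpos h1K (by linarith) (by linarith)
      rw [Real.mul_rpow (by norm_num) hK0] at h1
      have h2 : (1 : ℝ) / 4 ≤ 2 ^ (-α) := by
        calc (1 : ℝ) / 4 = 2 ^ (-2 : ℝ) := by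
              rw [Real.rpow_neg (by norm_num)]; norm_num
          _ ≤ _ := Real.rpow_le_rpow_of_exponent_le (by norm_num) (by linarith)
      have h3 : 0 ≤ K ^ (-α) := by positivity
      nlinarith
    calc green ν z ≤ ENNReal.ofReal (8 * A * K ^ (-α)) + ENNReal.ofReal (c₁ * K ^ (-α)) := by
          rw [hsum]; gcongr
      _ = ENNReal.ofReal ((8 * A + c₁) * K ^ (-α)) := by
          rw [← ENNReal.ofReal_add (by positivity) (by positivity), add_mul]
      _ ≤ _ := by
          refine ENNReal.ofReal_le_ofReal ?_
          calc (8 * A + c₁) * K ^ (-α) ≤ (8 * A + c₁) * (4 * (1 + K) ^ (-α)) := by gcongr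
            _ = 4 * (8 * A + c₁) * (1 + K) ^ (-α) := by ring
            _ ≤ _ := by
              gcongr
              have : 0 ≤ (1 + K₀) ^ α := by positivity
              linarith

/-! ### Overlap of two Green functions -/

lemma tsum_ofReal_int_rpow_lt_top {C p : ℝ} (hC : 0 ≤ C) (hp : 1 < p) :
    ∑' l : ℤ, ENNReal.ofReal (C * (1 + |(l : ℝ)|) ^ (-p)) < ∞ := by
  have hs : Summable fun l : ℤ ↦ |(l : ℝ)| ^ (-p) + if l = 0 then (1 : ℝ) else 0 :=
    (Real.summable_abs_int_rpow hp).add (hasSum_ite_eq 0 1).summable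
  have hs' : Summable fun l : ℤ ↦ C * (1 + |(l : ℝ)|) ^ (-p) := by
    refine Summable.mul_left C (hs.of_nonneg_of_le (fun l ↦ by positivity) fun l ↦ ?_)
    by_cases hl : l = 0
    · subst hl
      simp [Real.zero_rpow (by linarith : -p ≠ 0)]
    · rw [if_neg hl, add_zero]
      have : 0 < |(l : ℝ)| := abs_pos.2 (by exact_mod_cast hl)
      exact Real.rpow_le_rpow_of_nonpos this (by linarith) (by linarith)
  rw [← ENNReal.ofReal_tsum_of_nonneg (fun l ↦ by positivity) hs']
  exact ENNReal.ofReal_lt_top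

/-- Summing over the levels, on each of which the Green function has mass at most one. -/
lemma tsum_level_mul_green_le [NeZero d] {ν : Measure (Lattice d)} [IsProbabilityMeasure ν]
    (hlev : ∀ᵐ v ∂ν, 1 ≤ v 0) (b : ℤ → ℝ≥0∞) (u : Lattice d) :
    ∑' x : Lattice d, b (x 0) * green ν (x + u) ≤ ∑' l, b l := by
  calc ∑' x : Lattice d, b (x 0) * green ν (x + u)
      = ∑' x : Lattice d, ∑' l, b l * (if x 0 = l then green ν (x + u) else 0) := by
        refine tsum_congr fun x ↦ ?_
        rw [tsum_eq_single (x 0) fun l hl ↦ by rw [if_neg (Ne.symm hl), mul_zero], if_pos rfl]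
    _ = ∑' l, b l * ∑' x : Lattice d, (if x 0 = l then green ν (x + u) else 0) := by
        rw [ENNReal.tsum_comm]
        exact tsum_congr fun l ↦ ENNReal.tsum_mul_left
    _ ≤ ∑' l, b l * 1 := by
        refine ENNReal.tsum_le_tsum fun l ↦ mul_le_mul_right ?_ _
        refine le_trans (le_of_eq ?_) (tsum_level_green_le hlev (l + u 0))
        rw [← (Equiv.addRight u).tsum_eq
          (fun x : Lattice d ↦ if x 0 = l + u 0 then green ν x else 0)]
        refine tsum_congr fun x ↦ ?_
        simp
    _ = ∑' l, b l := by simp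

/-- The overlap `∑ x, g x * g (x + u)` of two Green functions decays in `u`. -/
lemma green_overlap_le [NeZero d] {ν : Measure (Lattice d)} [IsProbabilityMeasure ν]
    (hlev : ∀ᵐ v ∂ν, 1 ≤ v 0) {C α γ : ℝ} (hC : 0 ≤ C) (hγ0 : 0 ≤ γ) (hγ1 : γ ≤ 1) (hγα : γ ≤ α)
    (hg : ∀ z, green ν z ≤ ENNReal.ofReal (C * (1 + ‖z‖) ^ (-α))) (u : Lattice d) :
    ENNReal.ofReal ((1 + ‖u‖) ^ γ) * ∑' x, green ν x * green ν (x + u) ≤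
      2 * ∑' l : ℤ, ENNReal.ofReal (C * (1 + |(l : ℝ)|) ^ (-(α - γ))) := by
  set b : ℤ → ℝ≥0∞ := fun l ↦ ENNReal.ofReal (C * (1 + |(l : ℝ)|) ^ (-(α - γ))) with hb
  have hweight : ∀ x : Lattice d, ENNReal.ofReal ((1 + ‖x‖) ^ γ) * green ν x ≤ b (x 0) := by
    intro x
    have hx : 0 < 1 + ‖x‖ := by positivity
    calc ENNReal.ofReal ((1 + ‖x‖) ^ γ) * green ν x
        ≤ ENNReal.ofReal ((1 + ‖x‖) ^ γ) * ENNReal.ofReal (C * (1 + ‖x‖) ^ (-α)) := by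
          gcongr; exact hg x
      _ = ENNReal.ofReal (C * (1 + ‖x‖) ^ (-(α - γ))) := by
          rw [← ENNReal.ofReal_mul (by positivity), show -(α - γ) = γ + -α by ring,
            Real.rpow_add hx]
          congr 1
          ring
      _ ≤ b (x 0) := by
          refine ENNReal.ofReal_le_ofReal (mul_le_mul_of_nonneg_left ?_ hC)
          refine Real.rpow_le_rpow_of_nonpos (by positivity) ?_ (by linarith)
          have := norm_le_pi_norm x 0
          rw [Int.norm_eq_abs] at this
          linarith
  have hsplit : ∀ x : Lattice d, ENNReal.ofReal ((1 + ‖u‖) ^ γ) ≤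
      ENNReal.ofReal ((1 + ‖x‖) ^ γ) + ENNReal.ofReal ((1 + ‖x + u‖) ^ γ) := by
    intro x
    rw [← ENNReal.ofReal_add (by positivity) (by positivity)]
    refine ENNReal.ofReal_le_ofReal ?_
    calc (1 + ‖u‖) ^ γ ≤ ((1 + ‖x‖) + (1 + ‖x + u‖)) ^ γ := by
          refine Real.rpow_le_rpow (by positivity) ?_ hγ0
          have : ‖u‖ ≤ ‖x + u‖ + ‖x‖ := by
            calc ‖u‖ = ‖(x + u) - x‖ := by rw [add_sub_cancel_left]
              _ ≤ _ := norm_sub_le _ _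
          linarith
      _ ≤ _ := Real.rpow_add_le_add_rpow (by positivity) (by positivity) hγ0 hγ1
  calc ENNReal.ofReal ((1 + ‖u‖) ^ γ) * ∑' x, green ν x * green ν (x + u)
      = ∑' x, ENNReal.ofReal ((1 + ‖u‖) ^ γ) * (green ν x * green ν (x + u)) :=
        ENNReal.tsum_mul_left.symm
    _ ≤ ∑' x : Lattice d, (b (x 0) * green ν (x + u) + b ((x + u) 0) * green ν x) := by
        refine ENNReal.tsum_le_tsum fun x ↦ ?_
        calc ENNReal.ofReal ((1 + ‖u‖) ^ γ) * (green ν x * green ν (x + u))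
            ≤ (ENNReal.ofReal ((1 + ‖x‖) ^ γ) + ENNReal.ofReal ((1 + ‖x + u‖) ^ γ)) *
              (green ν x * green ν (x + u)) := by gcongr; exact hsplit x
          _ = (ENNReal.ofReal ((1 + ‖x‖) ^ γ) * green ν x) * green ν (x + u) +
              (ENNReal.ofReal ((1 + ‖x + u‖) ^ γ) * green ν (x + u)) * green ν x := by ring
          _ ≤ _ := by
              gcongr
              · exact hweight x
              · exact hweight (x + u)
    _ ≤ 2 * ∑' l, b l := by
        rw [ENNReal.tsum_add, two_mul]
        refine add_le_add (tsum_level_mul_green_le hlev b u) ?_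
        refine le_trans (le_of_eq ?_) (tsum_level_mul_green_le hlev b (-u))
        rw [← (Equiv.addRight u).tsum_eq (fun x : Lattice d ↦ b (x 0) * green ν (x + -u))]
        refine tsum_congr fun x ↦ ?_
        simp

/-- The convolution of the Green function with an occupation profile `S`. -/
noncomputable def greenConv (ν : Measure (Lattice d)) (S : Lattice d → ℝ≥0∞) (x : Lattice d) :
    ℝ≥0∞ := ∑' y, green ν y * S (x - y)

lemma greenConv_eq (ν : Measure (Lattice d)) (S : Lattice d → ℝ≥0∞) (x U : Lattice d) :
    greenConv ν S (x - U) = ∑' a, S a * green ν (x - U - a) := by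
  rw [greenConv, ← (Equiv.subLeft (x - U)).tsum_eq]
  refine tsum_congr fun a ↦ ?_
  simp [mul_comm]

/-- Smearing the two Green functions by profiles with a first moment does not change the decay of
their overlap. -/
lemma greenConv_overlap_le {ν : Measure (Lattice d)} {γ : ℝ} (hγ0 : 0 ≤ γ) (hγ1 : γ ≤ 1)
    {B : ℝ≥0∞}
    (hB : ∀ u, ENNReal.ofReal ((1 + ‖u‖) ^ γ) * ∑' x, green ν x * green ν (x + u) ≤ B)
    (S : Lattice d → ℝ≥0∞) (U₁ U₂ : Lattice d) :
    ENNReal.ofReal (‖U₁ - U₂‖ ^ γ) *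
        ∑' x, greenConv ν S (x - U₁) * greenConv ν S (x - U₂) ≤
      B * (∑' a, S a * (1 + ‖a‖ₑ)) ^ 2 := by
  have hone : ∀ a : Lattice d, (1 + ‖a‖ₑ) = ENNReal.ofReal (1 + ‖a‖) := fun a ↦ by
    rw [ENNReal.ofReal_add zero_le_one (norm_nonneg _), ENNReal.ofReal_one, ofReal_norm]
  have hshift : ∀ a b : Lattice d,
      ∑' x, green ν (x - U₁ - a) * green ν (x - U₂ - b) =
      ∑' x, green ν x * green ν (x + (U₁ + a - U₂ - b)) := by
    intro a b
    rw [← (Equiv.addRight (U₁ + a)).tsum_eq]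
    refine tsum_congr fun x ↦ ?_
    simp only [Equiv.coe_addRight]
    congr 2 <;> abel
  have hweight : ∀ a b : Lattice d, ENNReal.ofReal (‖U₁ - U₂‖ ^ γ) ≤
      (1 + ‖a‖ₑ) * (1 + ‖b‖ₑ) * ENNReal.ofReal ((1 + ‖U₁ + a - U₂ - b‖) ^ γ) := by
    intro a b
    rw [hone, hone, ← ENNReal.ofReal_mul (by positivity), ← ENNReal.ofReal_mul (by positivity)]
    refine ENNReal.ofReal_le_ofReal ?_
    have hpow : ∀ t : ℝ, 0 ≤ t → (1 + t) ^ γ ≤ 1 + t := fun t ht ↦ by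
      calc (1 + t) ^ γ ≤ (1 + t) ^ (1 : ℝ) :=
            Real.rpow_le_rpow_of_exponent_le (by linarith) hγ1
        _ = 1 + t := Real.rpow_one _
    have htri : ‖U₁ - U₂‖ ≤ (1 + ‖a‖) * (1 + ‖b‖) * (1 + ‖U₁ + a - U₂ - b‖) := by
      have h1 : ‖U₁ - U₂‖ ≤ ‖U₁ + a - U₂ - b‖ + ‖a‖ + ‖b‖ := by
        calc ‖U₁ - U₂‖ = ‖(U₁ + a - U₂ - b) - a + b‖ := by congr 1; abel
          _ ≤ ‖(U₁ + a - U₂ - b) - a‖ + ‖b‖ := norm_add_le _ _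
          _ ≤ _ := by gcongr; exact norm_sub_le _ _
      have ha := norm_nonneg a
      have hb := norm_nonneg b
      have hu := norm_nonneg (U₁ + a - U₂ - b)
      nlinarith [mul_nonneg ha hb, mul_nonneg ha hu, mul_nonneg hb hu,
        mul_nonneg (mul_nonneg ha hb) hu]
    calc ‖U₁ - U₂‖ ^ γ ≤ ((1 + ‖a‖) * (1 + ‖b‖) * (1 + ‖U₁ + a - U₂ - b‖)) ^ γ :=
          Real.rpow_le_rpow (norm_nonneg _) htri hγ0
      _ = (1 + ‖a‖) ^ γ * (1 + ‖b‖) ^ γ * (1 + ‖U₁ + a - U₂ - b‖) ^ γ := by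
          rw [Real.mul_rpow (by positivity) (by positivity),
            Real.mul_rpow (by positivity) (by positivity)]
      _ ≤ _ := by
          gcongr
          · exact hpow _ (norm_nonneg a)
          · exact hpow _ (norm_nonneg b)
  calc ENNReal.ofReal (‖U₁ - U₂‖ ^ γ) *
        ∑' x, greenConv ν S (x - U₁) * greenConv ν S (x - U₂)
      = ENNReal.ofReal (‖U₁ - U₂‖ ^ γ) * ∑' a, ∑' b, S a * S b *
          ∑' x, green ν (x - U₁ - a) * green ν (x - U₂ - b) := by
        congr 1
        calc ∑' x, greenConv ν S (x - U₁) * greenConv ν S (x - U₂)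
            = ∑' x, ∑' a, ∑' b, S a * S b *
                (green ν (x - U₁ - a) * green ν (x - U₂ - b)) := by
              refine tsum_congr fun x ↦ ?_
              rw [greenConv_eq, greenConv_eq, ← ENNReal.tsum_mul_right]
              refine tsum_congr fun a ↦ ?_
              rw [← ENNReal.tsum_mul_left]
              exact tsum_congr fun b ↦ by ring
          _ = _ := by
              rw [ENNReal.tsum_comm]
              refine tsum_congr fun a ↦ ?_
              rw [ENNReal.tsum_comm]
              exact tsum_congr fun b ↦ ENNReal.tsum_mul_left
    _ = ∑' a, ∑' b, S a * S b * (ENNReal.ofReal (‖U₁ - U₂‖ ^ γ) *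
          ∑' x, green ν x * green ν (x + (U₁ + a - U₂ - b))) := by
        rw [← ENNReal.tsum_mul_left]
        refine tsum_congr fun a ↦ ?_
        rw [← ENNReal.tsum_mul_left]
        refine tsum_congr fun b ↦ ?_
        rw [hshift]
        ring
    _ ≤ ∑' a, ∑' b, (S a * (1 + ‖a‖ₑ)) * (S b * (1 + ‖b‖ₑ)) * B := by
        refine ENNReal.tsum_le_tsum fun a ↦ ENNReal.tsum_le_tsum fun b ↦ ?_
        calc S a * S b * (ENNReal.ofReal (‖U₁ - U₂‖ ^ γ) *
              ∑' x, green ν x * green ν (x + (U₁ + a - U₂ - b)))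
            ≤ S a * S b * ((1 + ‖a‖ₑ) * (1 + ‖b‖ₑ) *
                ENNReal.ofReal ((1 + ‖U₁ + a - U₂ - b‖) ^ γ) *
                ∑' x, green ν x * green ν (x + (U₁ + a - U₂ - b))) := by
              gcongr; exact hweight a b
          _ = (S a * (1 + ‖a‖ₑ)) * (S b * (1 + ‖b‖ₑ)) *
                (ENNReal.ofReal ((1 + ‖U₁ + a - U₂ - b‖) ^ γ) *
                ∑' x, green ν x * green ν (x + (U₁ + a - U₂ - b))) := by ring
          _ ≤ _ := by gcongr; exact hB _
    _ = B * (∑' a, S a * (1 + ‖a‖ₑ)) ^ 2 := by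
        simp_rw [ENNReal.tsum_mul_right, ENNReal.tsum_mul_left]
        rw [ENNReal.tsum_mul_right]
        ring

/-! ### The renewal inequality, iterated -/

/-- A subsolution `V` of the renewal equation that vanishes below level zero is dominated by the
convolution of the Green function with the source term. -/
lemma le_greenConv_of_renewal [NeZero d] {ν : Measure (Lattice d)} (hlev : ∀ᵐ v ∂ν, 1 ≤ v 0)
    {V S : Lattice d → ℝ≥0∞} (hV0 : ∀ x, x 0 < 0 → V x = 0)
    (hV : ∀ x, V x ≤ S x + ∫⁻ v, V (x - v) ∂ν) (x : Lattice d) : V x ≤ greenConv ν S x := by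
  have hconv : ∀ (n : ℕ) (x : Lattice d),
      ∑' y, convPow ν n y * ∫⁻ v, V (x - y - v) ∂ν = ∑' y, convPow ν (n + 1) y * V (x - y) := by
    intro n x
    calc ∑' y, convPow ν n y * ∫⁻ v, V (x - y - v) ∂ν
        = ∫⁻ v, ∑' y, convPow ν n y * V (x - y - v) ∂ν := by
          rw [lintegral_tsum fun y ↦ (measurable_of_countable _).aemeasurable]
          exact tsum_congr fun y ↦ (lintegral_const_mul _ (measurable_of_countable _)).symm
      _ = ∫⁻ v, ∑' y, convPow ν n (y - v) * V (x - y) ∂ν := by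
          refine lintegral_congr fun v ↦ ?_
          rw [← (Equiv.addRight v).tsum_eq (fun y : Lattice d ↦ convPow ν n (y - v) * V (x - y))]
          refine tsum_congr fun y ↦ ?_
          simp only [Equiv.coe_addRight, add_sub_cancel_right]
          rw [sub_sub]
      _ = _ := by
          rw [lintegral_tsum fun y ↦ (measurable_of_countable _).aemeasurable]
          exact tsum_congr fun y ↦ lintegral_mul_const _ (measurable_of_countable _)
  have hiter : ∀ n : ℕ, V x ≤ (∑' y, greenUpTo ν n y * S (x - y)) +
      ∑' y, convPow ν n y * V (x - y) := by
    intro n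
    induction n with
    | zero =>
      rw [tsum_eq_single (f := fun y ↦ convPow ν 0 y * V (x - y)) 0]
      · simp [convPow]
      · intro y hy
        simp [convPow, hy]
    | succ n ih =>
      refine ih.trans ?_
      calc (∑' y, greenUpTo ν n y * S (x - y)) + ∑' y, convPow ν n y * V (x - y)
          ≤ (∑' y, greenUpTo ν n y * S (x - y)) +
            ∑' y, convPow ν n y * (S (x - y) + ∫⁻ v, V (x - y - v) ∂ν) := by
            gcongr with y
            exact hV _
        _ = _ := by
            simp_rw [mul_add]
            rw [ENNReal.tsum_add, hconv, ← add_assoc, ← ENNReal.tsum_add]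
            congr 1
            refine tsum_congr fun y ↦ ?_
            rw [greenUpTo, greenUpTo, Finset.sum_range_succ, add_mul]
  obtain ⟨n, hn⟩ : ∃ n : ℕ, x 0 < n := by
    obtain ⟨n, hn⟩ := exists_nat_gt (x 0)
    exact ⟨n, by exact_mod_cast hn⟩
  refine (hiter n).trans ?_
  have hzero : ∑' y, convPow ν n y * V (x - y) = 0 := by
    refine ENNReal.tsum_eq_zero.2 fun y ↦ ?_
    by_cases hy : y 0 < n
    · rw [convPow_eq_zero hlev hy, zero_mul]
    · rw [hV0 (x - y) (by rw [Pi.sub_apply]; lia), mul_zero]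
  rw [hzero, add_zero, greenConv]
  gcongr with y
  exact ENNReal.sum_le_tsum _

end RWRE

namespace RWRE

/-! ### Intersection of two walks -/

variable {d : ℕ} [NeZero d] (Q : Measure (SiteLaw d)) [IsProbabilityMeasure Q]

lemma visitWeight_eq_zero {x : Lattice d} (hx : x 0 < 0) : visitWeight Q x = 0 := by
  refine measure_mono_null ?_ (ae_iff.1 (ae_start Q 0))
  rintro X ⟨⟨i, hi⟩, hD⟩ h0
  have h1 := hD i
  rw [h0, hi] at h1
  exact absurd h1 (not_le.2 hx)

lemma visitWeight_le_greenConv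
    (htr : ∀ᵐ X ∂(annealed Q 0), Tendsto (fun n ↦ X n 0) atTop atTop) (x : Lattice d) :
    visitWeight Q x ≤
      annealed Q 0 (noBacktrack d) * greenConv (renewalLaw Q) (cycleOccupation Q) x := by
  refine (le_greenConv_of_renewal (ae_one_le_renewalLaw Q)
    (S := fun y ↦ annealed Q 0 (noBacktrack d) * cycleOccupation Q y)
    (fun x hx ↦ visitWeight_eq_zero Q hx) (fun x ↦ visitWeight_le Q htr x) x).trans (le_of_eq ?_)
  rw [greenConv, greenConv, ← ENNReal.tsum_mul_left]
  exact tsum_congr fun y ↦ by ring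

/-- The hitting probabilities of the conditioned walk are bounded by the Green function of the
regeneration points, smeared by the occupation of one cycle. -/
lemma cond_visit_le
    (htr : ∀ᵐ X ∂(annealed Q 0), Tendsto (fun n ↦ X n 0) atTop atTop) (U x : Lattice d) :
    (annealed Q U)[|noBacktrack d] {X | ∃ i, X i = x} ≤
      greenConv (renewalLaw Q) (cycleOccupation Q) (x - U) := by
  rw [cond_apply measurableSet_noBacktrack, annealed_noBacktrack, Set.inter_comm, annealed_visit]
  calc (annealed Q 0 (noBacktrack d))⁻¹ * visitWeight Q (x - U)
      ≤ (annealed Q 0 (noBacktrack d))⁻¹ * (annealed Q 0 (noBacktrack d) *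
          greenConv (renewalLaw Q) (cycleOccupation Q) (x - U)) := by
        gcongr
        exact visitWeight_le_greenConv Q htr _
    _ = _ := by
        rw [← mul_assoc, ENNReal.inv_mul_cancel (annealed_noBacktrack_ne_zero Q htr)
          (measure_ne_top _ _), one_mul]

/-- The union bound over the common site of the two independent walks. -/
lemma condPairLaw_pathsIntersect_le
    (htr : ∀ᵐ X ∂(annealed Q 0), Tendsto (fun n ↦ X n 0) atTop atTop) (U₁ U₂ : Lattice d) :
    condPairLaw Q U₁ U₂ (pathsIntersect d) ≤
      ∑' x, greenConv (renewalLaw Q) (cycleOccupation Q) (x - U₁) *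
        greenConv (renewalLaw Q) (cycleOccupation Q) (x - U₂) := by
  have hsub : pathsIntersect d ⊆
      ⋃ x : Lattice d, {X : Path d | ∃ i, X i = x} ×ˢ {X : Path d | ∃ i, X i = x} := by
    rintro ⟨X, Y⟩ ⟨x, ⟨i, hi⟩, ⟨j, hj⟩⟩
    exact Set.mem_iUnion.2 ⟨x, ⟨i, hi⟩, ⟨j, hj⟩⟩
  refine (measure_mono hsub).trans ((measure_iUnion_le _).trans (ENNReal.tsum_le_tsum fun x ↦ ?_))
  rw [condPairLaw, Measure.prod_prod]
  exact mul_le_mul' (cond_visit_le Q htr U₁ x) (cond_visit_le Q htr U₂ x)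

lemma regGapMoment_two_lt_top {r : ℝ} (hr : 2 ≤ r) (h : regGapMoment Q r < ∞) :
    regGapMoment Q 2 < ∞ := by
  refine lt_of_le_of_lt (lintegral_mono fun X ↦ ?_) h
  rcases Nat.eq_zero_or_pos (regTime X 1 - regTime X 0) with h0 | h0
  · rw [h0, Nat.cast_zero, ENNReal.zero_rpow_of_pos (by norm_num),
      ENNReal.zero_rpow_of_pos (by linarith)]
  · exact ENNReal.rpow_le_rpow_of_exponent_le (by exact_mod_cast h0) hr

omit [NeZero d] in
lemma integrable_norm_sq_of_lintegral {ν : Measure (Lattice d)} {M : ℝ≥0∞} (hM : M < ∞)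
    (h : ∫⁻ v, ‖v‖ₑ ^ 2 ∂ν ≤ M) :
    Integrable (fun v ↦ ‖v‖ ^ 2) ν ∧ ∫ v, ‖v‖ ^ 2 ∂ν ≤ M.toReal := by
  have henorm : ∀ v : Lattice d, ENNReal.ofReal (‖v‖ ^ 2) = ‖v‖ₑ ^ 2 := fun v ↦ by
    rw [ENNReal.ofReal_pow (norm_nonneg v), ofReal_norm]
  have hmeas : AEStronglyMeasurable (fun v : Lattice d ↦ ‖v‖ ^ 2) ν :=
    (measurable_of_countable _).aestronglyMeasurable
  have heq : ∫⁻ v, ENNReal.ofReal (‖v‖ ^ 2) ∂ν = ∫⁻ v, ‖v‖ₑ ^ 2 ∂ν :=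
    lintegral_congr henorm
  have h0 : 0 ≤ᵐ[ν] fun v ↦ ‖v‖ ^ 2 := ae_of_all _ fun v ↦ sq_nonneg ‖v‖
  refine ⟨⟨hmeas, ?_⟩, ?_⟩
  · rw [hasFiniteIntegral_iff_ofReal h0, heq]
    exact h.trans_lt hM
  · rw [integral_eq_lintegral_of_nonneg_ae h0 hmeas, heq]
    exact ENNReal.toReal_mono hM.ne h

end RWRE

theorem mainTheorem4 (d : ℕ) [NeZero d] (hd : 5 ≤ d) (κ : ℝ) (hκ : 0 < κ) :
    ∃ C : ℝ≥0∞ → ℝ,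
      ∀ (Q : Measure (RWRE.SiteLaw d)) [IsProbabilityMeasure Q],
        RWRE.UniformlyElliptic κ Q →
        (∃ v : EuclideanSpace ℝ (Fin d), 0 < v 0 ∧ RWRE.LawOfLargeNumbers Q v ∧
          ∃ S : Matrix (Fin d) (Fin d) ℝ, RWRE.AnnealedInvariancePrinciple Q v S) →
        (∃ ε : ℝ, 0 < ε ∧ RWRE.firstRegMoment Q ε < ∞) →
        (∃ r : ℝ, 2 ≤ r ∧ RWRE.regGapMoment Q r < ∞) →
        ∀ U₁ U₂ : RWRE.Lattice d, U₁ ≠ U₂ →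
          (RWRE.condPairLaw Q U₁ U₂).real (RWRE.pathsIntersect d) <
            C (RWRE.regGapMoment Q 2) *
              ‖U₁ - U₂‖ ^ (-(((d : ℝ) - 4) / ((d : ℝ) + 4))) := by
  have hd' : (5 : ℝ) ≤ d := by exact_mod_cast hd
  obtain ⟨δ, hδ⟩ : ∃ δ : ℝ, δ = min κ 1 ^ 4 := ⟨_, rfl⟩
  have hκ' : 0 < min κ 1 := lt_min hκ one_pos
  have hδ0 : 0 < δ := hδ ▸ pow_pos hκ' 4
  obtain ⟨α, hα⟩ : ∃ α : ℝ, α = 2 - 4 / (d : ℝ) := ⟨_, rfl⟩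
  obtain ⟨γ, hγ⟩ : ∃ γ : ℝ, γ = ((d : ℝ) - 4) / ((d : ℝ) + 4) := ⟨_, rfl⟩
  have hγ0 : 0 ≤ γ := hγ ▸ div_nonneg (by linarith) (by linarith)
  have hγ1 : γ ≤ 1 := by rw [hγ, div_le_one (by linarith)]; linarith
  -- `α - 1 = (d - 4) / d` exceeds `γ = (d - 4) / (d + 4)`.
  have hαγ : 1 < α - γ := by
    have h1 : γ < ((d : ℝ) - 4) / d := by
      rw [hγ]
      exact div_lt_div_of_pos_left (by linarith) (by linarith) (by linarith)
    have h2 : ((d : ℝ) - 4) / d = 1 - 4 / d := by field_simp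
    linarith
  choose C₀ hC₀ hgreen using fun M : ℝ≥0∞ ↦
    RWRE.exists_green_le hd hδ0 (A := max 1 M.toReal) (le_max_left _ _)
  let B : ℝ≥0∞ → ℝ≥0∞ := fun M ↦
    2 * ∑' l : ℤ, ENNReal.ofReal (C₀ M * (1 + |(l : ℝ)|) ^ (-(α - γ)))
  refine ⟨fun M ↦ (B M * M ^ 2).toReal + 1, ?_⟩
  rintro Q _ hQ ⟨v, hv, hlln, -⟩ - ⟨r, hr, hgap⟩ U₁ U₂ hU
  rw [← hγ]
  obtain ⟨M, hM⟩ : ∃ M, M = RWRE.regGapMoment Q 2 := ⟨_, rfl⟩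
  rw [← hM]
  have hMtop : M < ∞ := hM ▸ RWRE.regGapMoment_two_lt_top Q hr hgap
  have htr := RWRE.ae_tendsto_atTop Q hv hlln
  have hprob := RWRE.isProbabilityMeasure_renewalLaw Q htr
  have hlev := RWRE.ae_one_le_renewalLaw Q
  have hcycle : RWRE.cycleSecondMoment Q ≤ M := hM ▸ RWRE.cycleSecondMoment_le Q htr
  obtain ⟨hint, hmom⟩ := RWRE.integrable_norm_sq_of_lintegral hMtop
    ((RWRE.lintegral_enorm_sq_renewalLaw_le Q).trans hcycle)
  have hQ' : RWRE.UniformlyElliptic (min κ 1) Q := fun e ↦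
    measure_mono_null (fun p (hp : p.1 e < min κ 1) ↦ hp.trans_le (min_le_left _ _)) (hQ e)
  have hatoms : ∀ j, ∃ a : RWRE.Lattice d, δ ≤ (RWRE.renewalLaw Q).real {a} ∧
      δ ≤ (RWRE.renewalLaw Q).real {a + Pi.single j 1} := by
    intro j
    obtain ⟨a, ha, hb⟩ := RWRE.exists_atoms_renewalLaw Q (min_le_right κ 1) hQ' j
    rw [← ENNReal.ofReal_pow hκ'.le, ← hδ] at ha hb
    exact ⟨a, (ENNReal.ofReal_le_iff_le_toReal (measure_ne_top _ _)).1 ha,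
      (ENNReal.ofReal_le_iff_le_toReal (measure_ne_top _ _)).1 hb⟩
  have hg := hgreen M (RWRE.renewalLaw Q) hlev hint (hmom.trans (le_max_right _ _)) hatoms
  rw [← hα] at hg
  have hBtop : B M < ∞ := ENNReal.mul_lt_top (by simp)
    (RWRE.tsum_ofReal_int_rpow_lt_top (hC₀ M).le hαγ)
  have hoverlap := RWRE.greenConv_overlap_le hγ0 hγ1
    (RWRE.green_overlap_le hlev (hC₀ M).le hγ0 hγ1 (by linarith) hg)
    (RWRE.cycleOccupation Q) U₁ U₂
  have hfin : ENNReal.ofReal (‖U₁ - U₂‖ ^ γ) *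
      RWRE.condPairLaw Q U₁ U₂ (RWRE.pathsIntersect d) ≤ B M * M ^ 2 := by
    calc _ ≤ _ := mul_le_mul_right (RWRE.condPairLaw_pathsIntersect_le Q htr U₁ U₂) _
      _ ≤ _ := hoverlap
      _ ≤ B M * M ^ 2 := by
        gcongr
        exact (RWRE.tsum_cycleOccupation_le Q).trans hcycle
  have hne : 0 < ‖U₁ - U₂‖ := norm_pos_iff.2 (sub_ne_zero.2 hU)
  have hreal : ‖U₁ - U₂‖ ^ γ * (RWRE.condPairLaw Q U₁ U₂).real (RWRE.pathsIntersect d) ≤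
      (B M * M ^ 2).toReal := by
    have := ENNReal.toReal_mono (ENNReal.mul_lt_top hBtop (ENNReal.pow_lt_top hMtop)).ne hfin
    rwa [ENNReal.toReal_mul, ENNReal.toReal_ofReal (by positivity)] at this
  have hpos : 0 < ‖U₁ - U₂‖ ^ γ := Real.rpow_pos_of_pos hne γ
  rw [Real.rpow_neg hne.le, ← div_eq_mul_inv, lt_div_iff₀ hpos, mul_comm]
  exact hreal.trans_lt (lt_add_one _)
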